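/- Let $n\ge 1$ be an integer, $\lambda\in(0,\frac{2\pi}{n})$, $\mathbb{T}=\{z\in\mathbb{C}:|z|=1\}$ and \[ Q_n(\lambda;z)=\prod_{j=1}^{n}\bigl(1+e^{i(2j-n-1)\lambda/2}z\bigr). \] Let $\overline{\mathcal{D}}_n(\lambda)$ be the set of all complex polynomials $F$ of degree $n$ for which \[ \operatorname{Im}\left(e^{-in\lambda/2}\,\frac{F(e^{i\lambda/2}z)}{F(e^{-i\lambda/2}z)}\right)>0 \qquad\text{for all } z\in\mathbb{C} \text{ with } |z|>1, \] (the denominator being required not to vanish there), and let $\overline{\mathcal{T}}_n(\lambda)$ be the set of all complex polynomials of degree $n$ that have zeros only on $\mathbb{T}$, with each pair of zeros (counted with multiplicity) separated by an angle of at least $\lambda$. Let $P$ be a complex polynomial of degree $n$ all of whose zeros lie on $\mathbb{T}$, and set $F(z):=P(z)-Q_n(\lambda;z)$. For $c\in\mathbb{T}\setminus\{\pm1\}$ and $a,b\in\mathbb{R}$ consider the identity of rational functions \[ P(z)=c\left(b+a\sum_{k=1}^{n}\frac{e^{i(k-n-1)\lambda/2}}{\sin\frac{(k-n-1)\lambda}{2}}\cdot\frac{1+e^{i(n+1)\lambda/2}z}{1+e^{i(2k-n-1)\lambda/2}z}\right)Q_n(\lambda;z).\qquad(*)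 \] 1. Suppose that $F$ has degree $n$ and all its zeros lie in the closed unit disk. Then $F\in\overline{\mathcal{D}}_n(\lambda)\setminus\overline{\mathcal{T}}_n(\lambda)$ if, and only if, there are $c\in\mathbb{T}\setminus\{\pm1\}$ and $a,b\in\mathbb{R}$ with $a\neq0$ such that $(*)$ holds. 2. Without any assumption on the zeros or the degree of $F$: $F\in\overline{\mathcal{D}}_n(\lambda)\setminus\overline{\mathcal{T}}_n(\lambda)$ if, and only if, there are $c\in\mathbb{T}\setminus\{\pm1\}$ and $a,b\in\mathbb{R}$ with $a\,\operatorname{Im}c<0$ such that $(*)$ holds. -/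

import Mathlib

noncomputable section

namespace CirclePoly

open Polynomial

/-- The point `e^{i t}` of the unit circle. -/
def cis (t : ℝ) : ℂ := Complex.exp ((t : ℂ) * Complex.I)

/-- `π_n(Ω)`: the complex polynomials of degree exactly `n` all of whose zeros lie in `Ω`. -/
def piClass (n : ℕ) (Ω : Set ℂ) : Set ℂ[X] :=
  {P | P.degree = (n : WithBot ℕ) ∧ ∀ z : ℂ, P.IsRoot z → z ∈ Ω}

/-- `Q_n(λ; z) = ∏_{j=1}^n (1 + e^{i(2j-n-1)λ/2} z)`. -/
def Q (n : ℕ) (lam : ℝ) : ℂ[X] :=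
  ∏ j ∈ Finset.Icc 1 n, (1 + C (cis ((2 * (j : ℝ) - n - 1) * lam / 2)) * X)

/-- `F_+(z) = F(e^{iλ/2} z)`. -/
def plus (lam : ℝ) (F : ℂ[X]) : ℂ[X] := F.comp (C (cis (lam / 2)) * X)

/-- `F_-(z) = F(e^{-iλ/2} z)`. -/
def minus (lam : ℝ) (F : ℂ[X]) : ℂ[X] := F.comp (C (cis (-lam / 2)) * X)

/-- The class of polynomials of degree `n` with zeros only on the unit circle, each pair of zeros
(taken with multiplicity) being separated by an angle of at least `λ`. The angle between two zeros
is the unsigned one in `[0, π]`. -/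
def TBar (n : ℕ) (lam : ℝ) : Set ℂ[X] :=
  {F | F ∈ piClass n (Metric.sphere 0 1) ∧
    F.roots.Pairwise (fun z w => lam ≤ InnerProductGeometry.angle z w)}

/-- The class of polynomials `F` of degree `n` with `Im (e^{-inλ/2} F_+(z) / F_-(z)) > 0` for
`|z| > 1`. Where `F_-` vanishes the quotient is `0` in Lean and the inequality fails, so
membership includes that `F_-` has no zero in `|z| > 1`. -/
def DBar (n : ℕ) (lam : ℝ) : Set ℂ[X] :=
  {F | F.degree = (n : WithBot ℕ) ∧ ∀ z : ℂ, 1 < ‖z‖ →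
    0 < (cis (-((n : ℝ) * lam / 2)) * ((plus lam F).eval z / (minus lam F).eval z)).im}

/-- The identity of rational functions
`P(z) = c (b + a ∑_{k=1}^n e^{i(k-n-1)λ/2} / sin((k-n-1)λ/2) *
  (1 + e^{i(n+1)λ/2} z) / (1 + e^{i(2k-n-1)λ/2} z)) Q_n(λ; z)`,
stated at all points where no denominator vanishes (these are all but finitely many points). -/
def HasForm (n : ℕ) (lam : ℝ) (P : ℂ[X]) (c : ℂ) (a b : ℝ) : Prop :=
  ∀ z : ℂ,
    (∀ k ∈ Finset.Icc 1 n, 1 + cis ((2 * (k : ℝ) - n - 1) * lam / 2) * z ≠ 0) →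
    P.eval z =
      c * ((b : ℂ) + (a : ℂ) * ∑ k ∈ Finset.Icc 1 n,
        cis (((k : ℝ) - n - 1) * lam / 2) / (Real.sin (((k : ℝ) - n - 1) * lam / 2) : ℂ) *
          ((1 + cis (((n : ℝ) + 1) * lam / 2) * z) /
            (1 + cis ((2 * (k : ℝ) - n - 1) * lam / 2) * z))) *
      (Q n lam).eval z

end CirclePoly

end

/-!
Write `q` for the normalized restriction `t ↦ e^{-int/2} Q(e^{it})` of `Q n lam` to the circle; it
is the real function `∏ 2 cos ((t + β_k) / 2)`. A polynomial `P` of degree `n` with zeros on the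
circle normalizes to `c r` with `|c| = 1` and `r` real. The polynomial `W = -i (2 X Q' - n Q)`
normalizes to `-2 q'`, and `W / Q` is a sum of Cayley transforms `tan ((t + β_k) / 2)`; the sum in
`HasForm` is this quotient up to a real constant, so `HasForm` says that `P = c (b' Q + a W)`
(`hasForm_iff`).

Let `F = P - Q` belong to `DBar`. On the circle the defining inequality becomes
`Im c * (q₊ r₋ - r₊ q₋) ≥ 0`, where the subscripts denote the shifts by `± λ/2`. If `Im c ≠ 0`, this function has a
minimum `0` at each point midway between consecutive zeros of `q`, so its derivative vanishes
there. That says that `r / q'` takes the same value at consecutive zeros of `q`, hence at all of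
them, and `r` is a real combination of `q` and `q'` (`DBar.exists_eq_combination`). The Wronskian
`q₊' q₋ - q₊ q₋'` is a negative multiple of a square (`cosProd_wronskian`), which gives
`a Im c ≤ 0`. If `Im c = 0` or `a = 0`, then `F` itself is a constant multiple of a real function on the
circle, and such members of `DBar` lie in `TBar` (`DBar.mem_TBar_of_real`): with `u = 1 / z` the
quotient in `DBar` is a product of Möbius factors, one for each zero of `F`, with values in the
upper half-plane on `|u| < 1`. The sum of their arguments is `nλ/2 < π` at `u = 0` and cannot
reach `π`, whereas two zeros closer than `λ` would each contribute `π` in the limit at their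
midpoint.

Conversely, let `F = c (b Q + a W) - Q` with `a Im c < 0`. With `θ = nλ/2` the quotient in `DBar`
equals `cos θ + sin θ (1 - T U) / (T + U)`, where `T` and `U` have negative imaginary part for
`|z| > 1`; hence it lies in the upper half-plane (`combination_mem_DBar`). As `F` has no zero on
the circle, it is not in `TBar`. If instead `a Im c > 0`, then `F` has no zero in the closed disk,
which settles the first claim.
-/

noncomputable section

namespace CirclePoly

open Polynomial Filter Topology

/-! ### Points of the unit circle -/

theorem cis_add (s t : ℝ) : cis (s + t) = cis s * cis t := by
  simp only [cis, Complex.ofReal_add, add_mul, Complex.exp_add]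

@[simp] theorem cis_zero : cis 0 = 1 := by simp [cis]

theorem cis_ne_zero (t : ℝ) : cis t ≠ 0 := Complex.exp_ne_zero _

@[simp] theorem norm_cis (t : ℝ) : ‖cis t‖ = 1 := Complex.norm_exp_ofReal_mul_I t

theorem cis_neg_mul (t : ℝ) : cis (-t) * cis t = 1 := by
  rw [← cis_add, neg_add_cancel, cis_zero]

theorem cis_eq (t : ℝ) : cis t = Real.cos t + Real.sin t * Complex.I := by
  simp [cis, Complex.exp_mul_I]

theorem conj_cis (t : ℝ) : (starRingEnd ℂ) (cis t) = cis (-t) := by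
  simp only [cis_eq, map_add, map_mul, Complex.conj_ofReal, Complex.conj_I, Real.cos_neg,
    Real.sin_neg]
  push_cast; ring

@[simp] theorem cis_im (t : ℝ) : (cis t).im = Real.sin t := Complex.exp_ofReal_mul_I_im t

theorem cis_nat_mul (m : ℕ) (t : ℝ) : cis (m * t) = cis t ^ m := by
  rw [cis, cis, ← Complex.exp_nat_mul]; push_cast; ring_nf

theorem cis_sum {ι : Type*} (s : Finset ι) (f : ι → ℝ) :
    cis (∑ i ∈ s, f i) = ∏ i ∈ s, cis (f i) := by
  simp only [cis, Complex.ofReal_sum, Finset.sum_mul, Complex.exp_sum]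

theorem cis_arg {z : ℂ} (hz : ‖z‖ = 1) : cis z.arg = z := by
  have := Complex.norm_mul_exp_arg_mul_I z
  rwa [hz, Complex.ofReal_one, one_mul] at this

theorem hasDerivAt_cis (t : ℝ) : HasDerivAt cis (cis t * Complex.I) t := by
  have h : HasDerivAt (fun s : ℝ => (s : ℂ) * Complex.I) (1 * Complex.I) t :=
    (Complex.ofRealCLM.hasDerivAt (x := t)).mul_const Complex.I
  have h' := h.cexp
  rw [one_mul] at h'
  exact h'

theorem one_add_cis (x : ℝ) : 1 + cis x = cis (x / 2) * (2 * Real.cos (x / 2) : ℝ) := by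
  have h : cis x = cis (x / 2) * cis (x / 2) := by rw [← cis_add]; ring_nf
  have h1 := cis_neg_mul (x / 2)
  have h2 : cis (x / 2) + cis (-(x / 2)) = (2 * Real.cos (x / 2) : ℝ) := by
    simp only [cis_eq, Real.cos_neg, Real.sin_neg]; push_cast; ring
  rw [h, ← h2]
  linear_combination -h1

theorem cis_sub_cis (s t : ℝ) :
    cis s - cis t = cis ((s + t) / 2) * (2 * Real.sin ((s - t) / 2) : ℝ) * Complex.I := by
  have hs : cis s = cis ((s + t) / 2) * cis ((s - t) / 2) := by rw [← cis_add]; ring_nf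
  have ht : cis t = cis ((s + t) / 2) * cis (-((s - t) / 2)) := by rw [← cis_add]; ring_nf
  rw [hs, ht, cis_eq ((s - t) / 2), cis_eq (-((s - t) / 2)), Real.cos_neg, Real.sin_neg]
  push_cast; ring

/-! ### The normalized restriction of a polynomial to the circle -/

/-- The function `t ↦ e^{-int/2} F(e^{it})`. For a polynomial of degree `n` with zeros on the unit
circle it is a constant multiple of a real function. -/
def trig (n : ℕ) (F : ℂ[X]) (t : ℝ) : ℂ := cis (-(n * t / 2)) * F.eval (cis t)

theorem trig_eq_zero_iff {n : ℕ} {F : ℂ[X]} {t : ℝ} :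
    trig n F t = 0 ↔ F.eval (cis t) = 0 := by
  simp [trig, cis_ne_zero]

theorem hasDerivAt_trig (n : ℕ) (F : ℂ[X]) (t : ℝ) :
    HasDerivAt (trig n F) (cis (-(n * t / 2)) *
      (Complex.I * (cis t * F.derivative.eval (cis t) - n / 2 * F.eval (cis t)))) t := by
  have h1 : HasDerivAt (fun t : ℝ => -((n : ℝ) * t / 2)) (-((n : ℝ) / 2)) t :=
    (((hasDerivAt_id t).const_mul (n : ℝ)).div_const 2).neg.congr_deriv (by ring)
  have h2 := (hasDerivAt_cis (-((n : ℝ) * t / 2))).scomp t h1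
  have h3 := (F.hasDerivAt (cis t)).scomp t (hasDerivAt_cis t)
  have h4 := h2.mul h3
  refine h4.congr_deriv ?_
  simp only [Function.comp_apply, smul_eq_mul, Complex.real_smul]
  push_cast; ring

theorem trig_sub (n : ℕ) (F G : ℂ[X]) (t : ℝ) : trig n (F - G) t = trig n F t - trig n G t := by
  simp [trig, mul_sub]

theorem trig_add (n : ℕ) (F G : ℂ[X]) (t : ℝ) : trig n (F + G) t = trig n F t + trig n G t := by
  simp [trig, mul_add]

theorem trig_C_mul (n : ℕ) (c : ℂ) (F : ℂ[X]) (t : ℝ) : trig n (C c * F) t = c * trig n F t := by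
  simp [trig]; ring

theorem trig_prod_X_sub_C (s : Multiset ℂ) (hs : ∀ a ∈ s, ‖a‖ = 1) :
    ∃ (K : ℂ) (r : ℝ → ℝ), ‖K‖ = 1 ∧
      ∀ t, trig (Multiset.card s) (s.map fun a => X - C a).prod t = K * r t := by
  induction s using Multiset.induction_on with
  | empty => exact ⟨1, 1, by simp, fun t => by simp [trig]⟩
  | cons a s ih =>
    obtain ⟨K, r, hK, h⟩ := ih fun b hb => hs b (Multiset.mem_cons_of_mem hb)
    have ha : cis a.arg = a := cis_arg (hs a (Multiset.mem_cons_self _ _))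
    refine ⟨K * (cis (a.arg / 2) * Complex.I), fun t => r t * (2 * Real.sin ((t - a.arg) / 2)),
      by simp [hK], fun t => ?_⟩
    have h1 : trig (Multiset.card (a ::ₘ s)) ((a ::ₘ s).map fun a => X - C a).prod t =
        trig (Multiset.card s) (s.map fun a => X - C a).prod t *
          (cis (-(t / 2)) * (cis t - a)) := by
      simp only [trig, Multiset.card_cons, Multiset.map_cons, Multiset.prod_cons, eval_mul,
        eval_sub, eval_X, eval_C]
      have : cis (-(((Multiset.card s + 1 : ℕ) : ℝ) * t / 2)) =
          cis (-((Multiset.card s : ℝ) * t / 2)) * cis (-(t / 2)) := by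
        rw [← cis_add]; push_cast; ring_nf
      rw [this]; ring
    have h2 : cis (-(t / 2)) * cis ((t + a.arg) / 2) = cis (a.arg / 2) := by
      rw [← cis_add]; ring_nf
    rw [h1, h t, ← h2]
    nth_rewrite 1 [← ha]
    rw [cis_sub_cis]
    push_cast; ring

/-- A polynomial with all zeros on the unit circle is, after normalization, a unimodular multiple of
a real function. -/
theorem exists_trig_eq_mul_real {n : ℕ} {P : ℂ[X]} (hP : P ∈ piClass n (Metric.sphere 0 1)) :
    ∃ (c : ℂ) (r : ℝ → ℝ), ‖c‖ = 1 ∧ ∀ t, trig n P t = c * r t := by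
  obtain ⟨hdeg, hz⟩ := hP
  have hP0 : P ≠ 0 := by rintro rfl; simp at hdeg
  have hsp : P.Splits := IsAlgClosed.splits P
  have hcard : Multiset.card P.roots = n := by
    rw [← hsp.natDegree_eq_card_roots]; exact natDegree_eq_of_degree_eq_some hdeg
  obtain ⟨K, r, hK, h⟩ := trig_prod_X_sub_C P.roots
    fun a ha => by simpa using hz a (isRoot_of_mem_roots ha)
  have hl : P.leadingCoeff ≠ 0 := leadingCoeff_ne_zero.mpr hP0
  have hl' : (‖P.leadingCoeff‖ : ℂ) ≠ 0 := by simpa using hl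
  refine ⟨P.leadingCoeff / ‖P.leadingCoeff‖ * K, fun t => ‖P.leadingCoeff‖ * r t, ?_, fun t => ?_⟩
  · simp [hK, hl]
  · conv_lhs => rw [hsp.eq_prod_roots]
    rw [trig_C_mul, ← hcard, h]
    push_cast
    field_simp

/-! ### Boundary behaviour of the defining inequality -/

theorem eval_plus (lam : ℝ) (F : ℂ[X]) (z : ℂ) :
    (plus lam F).eval z = F.eval (cis (lam / 2) * z) := by simp [plus]

theorem eval_minus (lam : ℝ) (F : ℂ[X]) (z : ℂ) :
    (minus lam F).eval z = F.eval (cis (-lam / 2) * z) := by simp [minus]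

theorem im_div_eq (w z : ℂ) :
    (w / z).im = (w * (starRingEnd ℂ) z).im / Complex.normSq z := by
  rw [Complex.div_im, Complex.mul_im, Complex.conj_re, Complex.conj_im]; ring

/-- The boundary form of the inequality that defines `DBar`, cleared of denominators. -/
theorem DBar.im_trig_nonneg {n : ℕ} {lam : ℝ} {F : ℂ[X]} (hF : F ∈ DBar n lam) (t : ℝ) :
    0 ≤ (trig n F (t + lam / 2) * (starRingEnd ℂ) (trig n F (t - lam / 2))).im := by
  set G : ℝ → ℝ := fun ρ => (cis (-((n : ℝ) * lam / 2)) * (plus lam F).eval (ρ * cis t) *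
    (starRingEnd ℂ) ((minus lam F).eval (ρ * cis t))).im with hG
  have hcont : Continuous G := by
    apply Complex.continuous_im.comp
    refine (continuous_const.mul ((plus lam F).continuous.comp (by fun_prop))).mul
      (Complex.continuous_conj.comp ((minus lam F).continuous.comp (by fun_prop)))
  have hlim : Tendsto G (𝓝[>] 1) (𝓝 (G 1)) := hcont.continuousAt.mono_left nhdsWithin_le_nhds
  have h1 : 0 ≤ G 1 := by
    refine ge_of_tendsto hlim ?_
    filter_upwards [self_mem_nhdsWithin] with ρ hρ
    have hρ1 : (1 : ℝ) < ρ := hρ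
    have := hF.2 (ρ * cis t) (by simp [abs_of_pos (by linarith : (0 : ℝ) < ρ), hρ1])
    rw [← mul_div_assoc, im_div_eq] at this
    by_contra hneg
    exact absurd this (not_lt.mpr (div_nonpos_of_nonpos_of_nonneg (not_le.mp hneg).le
      (Complex.normSq_nonneg _)))
  refine h1.trans_eq ?_
  have e1 : cis (lam / 2) * cis t = cis (t + lam / 2) := by rw [← cis_add, add_comm]
  have e2 : cis (-lam / 2) * cis t = cis (t - lam / 2) := by rw [← cis_add]; ring_nf
  have e3 : cis (-(n * lam / 2)) =
      cis (-(n * (t + lam / 2) / 2)) * cis (n * (t - lam / 2) / 2) := by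
    rw [← cis_add]; ring_nf
  simp only [hG, trig, eval_plus, eval_minus, Complex.ofReal_one, one_mul, e1, e2, map_mul,
    conj_cis, neg_neg]
  rw [e3]
  congr 1
  ring

/-! ### The extremal polynomial and its angular derivative -/

/-- The angle `β_k = (2k-n-1)λ/2`, so that the `k`-th factor of `Q n lam` is `1 + e^{iβ_k} X`. -/
def beta (n : ℕ) (lam : ℝ) (k : ℕ) : ℝ := (2 * (k : ℝ) - n - 1) * lam / 2

/-- The real function `∏ 2 cos ((t + β_k) / 2)`, the normalized restriction of `Q n lam` to the
circle. -/
def cosProd (n : ℕ) (lam : ℝ) (t : ℝ) : ℝ :=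
  ∏ k ∈ Finset.Icc 1 n, 2 * Real.cos ((t + beta n lam k) / 2)

/-- The polynomial `-i (2 X Q' - n Q)`. On the unit circle its normalization is `-2` times the
derivative of that of `Q n lam`. -/
def W (n : ℕ) (lam : ℝ) : ℂ[X] :=
  C (-Complex.I) * (2 * X * derivative (Q n lam) - C (n : ℂ) * Q n lam)

theorem Q_eq (n : ℕ) (lam : ℝ) :
    Q n lam = ∏ k ∈ Finset.Icc 1 n, (1 + C (cis (beta n lam k)) * X) := rfl

theorem eval_Q (n : ℕ) (lam : ℝ) (z : ℂ) :
    (Q n lam).eval z = ∏ k ∈ Finset.Icc 1 n, (1 + cis (beta n lam k) * z) := by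
  simp [Q_eq, eval_prod]

theorem sum_beta (n : ℕ) (lam : ℝ) : ∑ k ∈ Finset.Icc 1 n, beta n lam k = 0 := by
  have h : ∀ m : ℕ, ∑ k ∈ Finset.Icc 1 m, beta n lam k = m * (m - n : ℝ) * lam / 2 := by
    intro m
    induction m with
    | zero => simp
    | succ m ih => rw [Finset.sum_Icc_succ_top (by omega), ih, beta]; push_cast; ring
  rw [h]; ring

theorem trig_Q (n : ℕ) (lam t : ℝ) : trig n (Q n lam) t = cosProd n lam t := by
  have h : ∏ k ∈ Finset.Icc 1 n, cis ((t + beta n lam k) / 2) = cis (n * t / 2) := by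
    rw [← cis_sum, ← Finset.sum_div, Finset.sum_add_distrib, sum_beta]
    simp
  have h2 : (Q n lam).eval (cis t) = cis (n * t / 2) * cosProd n lam t := by
    rw [eval_Q, ← h, cosProd, Complex.ofReal_prod, ← Finset.prod_mul_distrib]
    refine Finset.prod_congr rfl fun k _ => ?_
    rw [← cis_add, one_add_cis, add_comm (beta n lam k)]
  rw [trig, h2, ← mul_assoc, cis_neg_mul, one_mul]

theorem differentiable_cosProd (n : ℕ) (lam : ℝ) : Differentiable ℝ (cosProd n lam) := by
  unfold cosProd; fun_prop

theorem trig_W (n : ℕ) (lam t : ℝ) : trig n (W n lam) t = (-2 * deriv (cosProd n lam) t : ℝ) := by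
  have h1 := ((differentiable_cosProd n lam t).hasDerivAt).ofReal_comp
  have h2 := hasDerivAt_trig n (Q n lam) t
  have h3 : trig n (Q n lam) = fun t => (cosProd n lam t : ℂ) := funext (trig_Q n lam)
  rw [h3] at h2
  have h4 := h1.unique h2
  push_cast
  rw [h4, trig, W]
  simp only [eval_mul, eval_sub, eval_C, eval_X, eval_ofNat]
  ring

/-- The functions `2 cos ((t + (2j-n)λ/2) / 2)`, `0 ≤ j ≤ n`. The factors of `cosProd n lam` shifted
by `λ/2` are those with `1 ≤ j ≤ n`, the factors shifted by `-λ/2` those with `0 ≤ j ≤ n - 1`. -/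
def cosFactor (n : ℕ) (lam : ℝ) (j : ℕ) (t : ℝ) : ℝ :=
  2 * Real.cos ((t + (2 * (j : ℝ) - n) * lam / 2) / 2)

theorem prod_Icc_one_eq_range {M : Type*} [CommMonoid M] (f : ℕ → M) (n : ℕ) :
    ∏ k ∈ Finset.Icc 1 n, f k = ∏ i ∈ Finset.range n, f (i + 1) := by
  induction n with
  | zero => simp
  | succ n ih => rw [Finset.prod_Icc_succ_top (by omega), ih, Finset.prod_range_succ]

theorem sum_Icc_one_eq_range {M : Type*} [AddCommMonoid M] (f : ℕ → M) (n : ℕ) :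
    ∑ k ∈ Finset.Icc 1 n, f k = ∑ i ∈ Finset.range n, f (i + 1) := by
  induction n with
  | zero => simp
  | succ n ih => rw [Finset.sum_Icc_succ_top (by omega), ih, Finset.sum_range_succ]

theorem cosProd_add (m : ℕ) (lam t : ℝ) : cosProd (m + 1) lam (t + lam / 2) =
    (∏ i ∈ Finset.range m, cosFactor (m + 1) lam (i + 1) t) * cosFactor (m + 1) lam (m + 1) t := by
  rw [cosProd, prod_Icc_one_eq_range, ← Finset.prod_range_succ]
  refine Finset.prod_congr rfl fun i _ => ?_
  simp only [cosFactor, beta]; push_cast; ring_nf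

theorem cosProd_sub (m : ℕ) (lam t : ℝ) : cosProd (m + 1) lam (t - lam / 2) =
    (∏ i ∈ Finset.range m, cosFactor (m + 1) lam (i + 1) t) * cosFactor (m + 1) lam 0 t := by
  rw [cosProd, prod_Icc_one_eq_range, ← Finset.prod_range_succ' (cosFactor (m + 1) lam · t)]
  refine Finset.prod_congr rfl fun i _ => ?_
  simp only [cosFactor, beta]; push_cast; ring_nf

theorem hasDerivAt_cosFactor (n : ℕ) (lam : ℝ) (j : ℕ) (t : ℝ) :
    HasDerivAt (cosFactor n lam j) (-Real.sin ((t + (2 * (j : ℝ) - n) * lam / 2) / 2)) t := by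
  have h : HasDerivAt (fun s : ℝ => (s + (2 * (j : ℝ) - n) * lam / 2) / 2) (1 / 2) t :=
    ((hasDerivAt_id t).add_const _).div_const 2
  exact (h.cos.const_mul 2).congr_deriv (by ring)

/-- The Wronskian of the two shifts of `cosProd` is a negative multiple of a square: only the two
factors that the shifts do not share contribute. -/
theorem cosProd_wronskian (m : ℕ) (lam t : ℝ) :
    deriv (cosProd (m + 1) lam) (t + lam / 2) * cosProd (m + 1) lam (t - lam / 2) -
      cosProd (m + 1) lam (t + lam / 2) * deriv (cosProd (m + 1) lam) (t - lam / 2) =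
    -2 * Real.sin ((m + 1 : ℝ) * lam / 2) *
      (∏ i ∈ Finset.range m, cosFactor (m + 1) lam (i + 1) t) ^ 2 := by
  set M : ℝ → ℝ := fun t => ∏ i ∈ Finset.range m, cosFactor (m + 1) lam (i + 1) t with hM
  have hMd : Differentiable ℝ M := by
    simp only [hM, cosFactor]; fun_prop
  have hp : HasDerivAt (fun s => cosProd (m + 1) lam (s + lam / 2))
      (deriv (cosProd (m + 1) lam) (t + lam / 2)) t :=
    (differentiable_cosProd (m + 1) lam _).hasDerivAt.comp_add_const t (lam / 2)
  have hq : HasDerivAt (fun s => cosProd (m + 1) lam (s - lam / 2))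
      (deriv (cosProd (m + 1) lam) (t - lam / 2)) t :=
    (differentiable_cosProd (m + 1) lam _).hasDerivAt.comp_sub_const t (lam / 2)
  have hp' : (fun s => cosProd (m + 1) lam (s + lam / 2)) =
      fun s => M s * cosFactor (m + 1) lam (m + 1) s := funext (cosProd_add m lam)
  have hq' : (fun s => cosProd (m + 1) lam (s - lam / 2)) =
      fun s => M s * cosFactor (m + 1) lam 0 s := funext (cosProd_sub m lam)
  rw [hp'] at hp
  rw [hq'] at hq
  have e1 := hp.unique ((hMd t).hasDerivAt.mul (hasDerivAt_cosFactor (m + 1) lam (m + 1) t))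
  have e2 := hq.unique ((hMd t).hasDerivAt.mul (hasDerivAt_cosFactor (m + 1) lam 0 t))
  rw [e1, e2, cosProd_add, cosProd_sub]
  have hsin : Real.sin ((m + 1 : ℝ) * lam / 2) =
      Real.sin ((t + (2 * ((m + 1 : ℕ) : ℝ) - (m + 1 : ℕ)) * lam / 2) / 2) *
        Real.cos ((t + (2 * ((0 : ℕ) : ℝ) - (m + 1 : ℕ)) * lam / 2) / 2) -
      Real.cos ((t + (2 * ((m + 1 : ℕ) : ℝ) - (m + 1 : ℕ)) * lam / 2) / 2) *
        Real.sin ((t + (2 * ((0 : ℕ) : ℝ) - (m + 1 : ℕ)) * lam / 2) / 2) := by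
    rw [← Real.sin_sub]; push_cast; ring_nf
  rw [hsin]
  simp only [hM, cosFactor]
  ring

/-- At `t = 0` every common factor is positive. -/
theorem prod_cosFactor_zero_pos {m : ℕ} {lam : ℝ}
    (hlam : lam ∈ Set.Ioo (0 : ℝ) (2 * Real.pi / (m + 1 : ℕ))) :
    0 < ∏ i ∈ Finset.range m, cosFactor (m + 1) lam (i + 1) 0 := by
  obtain ⟨h0, h1⟩ := hlam
  rw [lt_div_iff₀ (by positivity)] at h1
  refine Finset.prod_pos fun i hi => mul_pos two_pos (Real.cos_pos_of_mem_Ioo ?_)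
  have hi' : (i : ℝ) + 1 ≤ m := by exact_mod_cast Finset.mem_range.mp hi
  have hi0 : (0 : ℝ) ≤ i := by positivity
  push_cast at h1 ⊢
  constructor <;> nlinarith

theorem sin_half_pos {n : ℕ} (hn : 1 ≤ n) {lam : ℝ} (hlam : lam ∈ Set.Ioo (0 : ℝ) (2 * Real.pi / n))
    {x : ℝ} (hx : 0 < x) (hxn : x ≤ n) : 0 < Real.sin (x * lam / 2) := by
  obtain ⟨h0, h1⟩ := hlam
  have hn' : (0 : ℝ) < n := by exact_mod_cast hn
  rw [lt_div_iff₀ hn'] at h1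
  apply Real.sin_pos_of_pos_of_lt_pi (by positivity)
  nlinarith

theorem sin_beta_sub_ne_zero {n : ℕ} {lam : ℝ} (hlam : lam ∈ Set.Ioo (0 : ℝ) (2 * Real.pi / n))
    {k l : ℕ} (hk : k ∈ Finset.Icc 1 n) (hl : l ∈ Finset.Icc 1 n) (hkl : k ≠ l) :
    Real.sin ((beta n lam k - beta n lam l) / 2) ≠ 0 := by
  wlog h : l < k generalizing k l
  · have := this hl hk hkl.symm (by omega)
    rwa [← neg_sub, neg_div, Real.sin_neg, neg_ne_zero]
  rw [Finset.mem_Icc] at hk hl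
  have hk' : (k : ℝ) ≤ n := by exact_mod_cast hk.2
  have h' : (l : ℝ) < k := by exact_mod_cast h
  have hl0 : (0 : ℝ) ≤ l := by positivity
  have := sin_half_pos (x := (k : ℝ) - l) (hk.1.trans hk.2) hlam (by linarith) (by linarith)
  have e : (beta n lam k - beta n lam l) / 2 = ((k : ℝ) - l) * lam / 2 := by
    simp only [beta]; ring
  rw [e]; exact this.ne'

/-- The zeros of `cosProd` are simple. -/
theorem deriv_cosProd_ne_zero {n : ℕ} {lam : ℝ} (hlam : lam ∈ Set.Ioo (0 : ℝ) (2 * Real.pi / n))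
    {t : ℝ} (ht : cosProd n lam t = 0) : deriv (cosProd n lam) t ≠ 0 := by
  obtain ⟨k, hk, hk0⟩ := Finset.prod_eq_zero_iff.mp ht
  have hc : Real.cos ((t + beta n lam k) / 2) = 0 := by simpa using hk0
  set M : ℝ → ℝ := fun t =>
    ∏ l ∈ (Finset.Icc 1 n).erase k, 2 * Real.cos ((t + beta n lam l) / 2) with hM
  have hMd : Differentiable ℝ M := by simp only [hM]; fun_prop
  have hfac : cosProd n lam = fun s => 2 * Real.cos ((s + beta n lam k) / 2) * M s :=
    funext fun s => (Finset.mul_prod_erase _ _ hk).symm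
  have h : HasDerivAt (fun s : ℝ => (s + beta n lam k) / 2) (1 / 2) t :=
    ((hasDerivAt_id t).add_const _).div_const 2
  have hd := (h.cos.const_mul 2).mul (hMd t).hasDerivAt
  have hd' : deriv (cosProd n lam) t = -Real.sin ((t + beta n lam k) / 2) * M t := by
    rw [hfac]
    refine hd.deriv.trans ?_
    rw [hc]; ring
  rw [hd']
  refine mul_ne_zero (fun hs => ?_) (Finset.prod_ne_zero_iff.mpr fun l hl => ?_)
  · have := Real.sin_sq_add_cos_sq ((t + beta n lam k) / 2)
    rw [hc, neg_eq_zero.mp hs] at this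
    norm_num at this
  · rw [Finset.mem_erase] at hl
    intro hl0
    have hcl : Real.cos ((t + beta n lam l) / 2) = 0 := by simpa using hl0
    refine sin_beta_sub_ne_zero hlam hk hl.2 hl.1.symm ?_
    have : (beta n lam k - beta n lam l) / 2 =
        (t + beta n lam k) / 2 - (t + beta n lam l) / 2 := by ring
    rw [this, Real.sin_sub, hc, hcl]; ring

theorem cosProd_pi_sub_beta {n k : ℕ} (hk : k ∈ Finset.Icc 1 n) (lam : ℝ) :
    cosProd n lam (Real.pi - beta n lam k) = 0 :=
  Finset.prod_eq_zero hk (by simp)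

theorem cis_pi_sub_beta_injOn {n : ℕ} {lam : ℝ}
    (hlam : lam ∈ Set.Ioo (0 : ℝ) (2 * Real.pi / n)) :
    Set.InjOn (fun k => cis (Real.pi - beta n lam k)) (Finset.Icc 1 n : Finset ℕ) := by
  intro k hk l hl h
  by_contra hkl
  have h0 := sub_eq_zero.mpr h
  simp only at h0
  rw [cis_sub_cis] at h0
  have h1 : Real.sin ((Real.pi - beta n lam k - (Real.pi - beta n lam l)) / 2) = 0 := by
    simpa [cis_ne_zero, -Complex.ofReal_sin] using h0
  refine sin_beta_sub_ne_zero hlam hl hk (Ne.symm hkl) ?_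
  rw [← h1]; ring_nf

theorem natDegree_Q (n : ℕ) (lam : ℝ) : (Q n lam).natDegree = n := by
  have h : ∀ k, (1 + C (cis (beta n lam k)) * X).natDegree = 1 := fun k => by
    rw [add_comm, ← C_1]; exact natDegree_linear (cis_ne_zero _)
  rw [Q_eq, natDegree_prod _ _ fun k _ h0 => by simpa [h0] using h k]
  simp [h]

theorem Q_ne_zero (n : ℕ) (lam : ℝ) : Q n lam ≠ 0 := by
  intro h
  have : (Q n lam).eval 0 = 1 := by simp [eval_Q]
  simp [h] at this

theorem coeff_Q_ne_zero (n : ℕ) (lam : ℝ) : (Q n lam).coeff n ≠ 0 := by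
  have := leadingCoeff_ne_zero.mpr (Q_ne_zero n lam)
  rwa [leadingCoeff, natDegree_Q] at this

theorem coeff_W (n : ℕ) (lam : ℝ) : (W n lam).coeff n = -Complex.I * n * (Q n lam).coeff n := by
  have h : (X * derivative (Q n lam)).coeff n = n * (Q n lam).coeff n := by
    cases n with
    | zero => simp
    | succ m => rw [coeff_X_mul, coeff_derivative]; push_cast; ring
  rw [W, mul_assoc, coeff_C_mul, coeff_sub, coeff_C_mul, ← C_ofNat, coeff_C_mul, h]
  ring

theorem natDegree_W_le (n : ℕ) (lam : ℝ) : (W n lam).natDegree ≤ n := by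
  rw [natDegree_le_iff_coeff_eq_zero]
  intro N hN
  have hQ : (Q n lam).coeff N = 0 := coeff_eq_zero_of_natDegree_lt (by rw [natDegree_Q]; omega)
  have h : (X * derivative (Q n lam)).coeff N = 0 := by
    cases N with
    | zero => simp
    | succ m => rw [coeff_X_mul, coeff_derivative, hQ, zero_mul]
  rw [W, mul_assoc, coeff_C_mul, coeff_sub, coeff_C_mul, ← C_ofNat, coeff_C_mul, h, hQ]
  ring

/-- A polynomial of degree at most `n` that vanishes at the zeros of `Q n lam` is a constant
multiple of it. -/
theorem exists_eq_C_mul_Q {n : ℕ} {lam : ℝ} (hlam : lam ∈ Set.Ioo (0 : ℝ) (2 * Real.pi / n))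
    {N : ℂ[X]} (hN : N.natDegree ≤ n)
    (h : ∀ k ∈ Finset.Icc 1 n, N.eval (cis (Real.pi - beta n lam k)) = 0) :
    ∃ B : ℂ, N = C B * Q n lam := by
  refine ⟨N.coeff n / (Q n lam).coeff n, sub_eq_zero.mp ?_⟩
  refine eq_zero_of_degree_lt_of_eval_index_eq_zero _ (cis_pi_sub_beta_injOn hlam) ?_ fun k hk => ?_
  · rw [Nat.card_Icc, Nat.add_sub_cancel, degree_lt_iff_coeff_zero]
    intro m hm
    rcases hm.eq_or_lt with rfl | hm
    · rw [coeff_sub, coeff_C_mul, div_mul_cancel₀ _ (coeff_Q_ne_zero _ _), sub_self]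
    · rw [coeff_sub, coeff_C_mul, coeff_eq_zero_of_natDegree_lt (hN.trans_lt hm),
        coeff_eq_zero_of_natDegree_lt (p := Q n lam) (n := m) (by rw [natDegree_Q]; exact hm)]
      ring
  · have : (Q n lam).eval (cis (Real.pi - beta n lam k)) = 0 := by
      rw [← trig_eq_zero_iff (n := n), trig_Q, cosProd_pi_sub_beta hk, Complex.ofReal_zero]
    simp [h k hk, this]

/-! ### Consequences of membership in `DBar` when the phase is not real -/

/-- If `c r - q` is the normalization of a member of `DBar`, where `q` is that of `Q n lam` and `r`
is real, then `Im c * (q₊ r₋ - r₊ q₋) ≥ 0`. -/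
theorem DBar.cross_nonneg {n : ℕ} {lam : ℝ} {P : ℂ[X]} {c : ℂ} {r : ℝ → ℝ}
    (hr : ∀ t, trig n P t = c * r t) (hF : P - Q n lam ∈ DBar n lam) (t : ℝ) :
    0 ≤ c.im * (cosProd n lam (t + lam / 2) * r (t - lam / 2) -
      r (t + lam / 2) * cosProd n lam (t - lam / 2)) := by
  have h := DBar.im_trig_nonneg hF t
  rw [trig_sub, trig_sub, hr, hr, trig_Q, trig_Q] at h
  refine h.trans_eq ?_
  simp [Complex.mul_im]
  ring

theorem differentiable_of_trig {n : ℕ} {P : ℂ[X]} {c : ℂ} {r : ℝ → ℝ} (hc : ‖c‖ = 1)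
    (hr : ∀ t, trig n P t = c * r t) : Differentiable ℝ r := by
  intro t
  have hc0 : c ≠ 0 := norm_ne_zero_iff.mp (by rw [hc]; exact one_ne_zero)
  have h := (hasDerivAt_trig n P t).const_mul c⁻¹
  have h2 := Complex.reCLM.hasFDerivAt.comp_hasDerivAt t h
  have e : (Complex.reCLM ∘ fun t => c⁻¹ * trig n P t) = r := by
    funext s
    simp [hr, hc0]
  rw [e] at h2
  exact h2.differentiableAt

/-- If the phase `c` of `P` is not real and `P - Q n lam` belongs to `DBar`, then the cross
expression `q₊ r₋ - r₊ q₋` has constant sign, and hence a critical point at each point midway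
between consecutive zeros of `q`. This forces `r / q'` to take the same value at all zeros of `q`,
so `r` is a real linear combination of `q` and `q'`. -/
theorem DBar.exists_eq_combination {n : ℕ} (hn : 1 ≤ n) {lam : ℝ}
    (hlam : lam ∈ Set.Ioo (0 : ℝ) (2 * Real.pi / n)) {P : ℂ[X]} (hP : P.natDegree ≤ n)
    {c : ℂ} {r : ℝ → ℝ} (hc : ‖c‖ = 1) (him : c.im ≠ 0) (hr : ∀ t, trig n P t = c * r t)
    (hF : P - Q n lam ∈ DBar n lam) :
    ∃ a b : ℝ, P = C c * (C (b : ℂ) * Q n lam + C (a : ℂ) * W n lam) := by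
  have hc0 : c ≠ 0 := norm_ne_zero_iff.mp (by rw [hc]; exact one_ne_zero)
  set q := cosProd n lam with hq
  have hrd := differentiable_of_trig hc hr
  have hqd : Differentiable ℝ q := differentiable_cosProd n lam
  have step : ∀ t, q (t + lam / 2) = 0 → q (t - lam / 2) = 0 →
      deriv q (t + lam / 2) * r (t - lam / 2) = r (t + lam / 2) * deriv q (t - lam / 2) := by
    intro t hp hm
    set D : ℝ → ℝ := fun t => c.im * (q (t + lam / 2) * r (t - lam / 2) -
      r (t + lam / 2) * q (t - lam / 2)) with hD
    have hmin : IsLocalMin D t := by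
      refine Eventually.of_forall fun s => ?_
      have h0 : D t = 0 := by simp [hD, hp, hm]
      rw [h0]
      exact DBar.cross_nonneg hr hF s
    have h1 := (hqd (t + lam / 2)).hasDerivAt.comp_add_const t (lam / 2)
    have h2 := (hqd (t - lam / 2)).hasDerivAt.comp_sub_const t (lam / 2)
    have h3 := (hrd (t + lam / 2)).hasDerivAt.comp_add_const t (lam / 2)
    have h4 := (hrd (t - lam / 2)).hasDerivAt.comp_sub_const t (lam / 2)
    have hDd := ((h1.mul h4).sub (h3.mul h2)).const_mul c.im
    have h5 := hmin.hasDerivAt_eq_zero hDd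
    rw [hp, hm] at h5
    have h6 := (mul_eq_zero.mp h5).resolve_left him
    linarith
  set ξ : ℕ → ℝ := fun k => Real.pi - beta n lam k with hξ
  have hzero : ∀ k ∈ Finset.Icc 1 n, q (ξ k) = 0 := fun k hk => cosProd_pi_sub_beta hk lam
  have hsimple : ∀ k ∈ Finset.Icc 1 n, deriv q (ξ k) ≠ 0 :=
    fun k hk => deriv_cosProd_ne_zero hlam (hzero k hk)
  set A : ℝ := r (ξ 1) / deriv q (ξ 1) with hA
  have hAk : ∀ k, 1 ≤ k → k ≤ n → r (ξ k) = A * deriv q (ξ k) := by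
    intro k hk
    induction k, hk using Nat.le_induction with
    | base =>
      intro h1
      rw [hA, div_mul_cancel₀ _ (hsimple 1 (by simp [h1]))]
    | succ k hk ih =>
      intro hkn
      have hk1 : k ∈ Finset.Icc 1 n := by simp; omega
      have hk2 : k + 1 ∈ Finset.Icc 1 n := by simp; omega
      have e1 : ξ k - lam / 2 + lam / 2 = ξ k := by ring
      have e2 : ξ k - lam / 2 - lam / 2 = ξ (k + 1) := by
        simp only [hξ, beta]; push_cast; ring
      have := step (ξ k - lam / 2) (by rw [e1]; exact hzero k hk1)
        (by rw [e2]; exact hzero _ hk2)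
      rw [e1, e2, ih (by omega)] at this
      refine mul_left_cancel₀ (hsimple k hk1) ?_
      rw [this]; ring
  obtain ⟨B, hB⟩ := exists_eq_C_mul_Q hlam (N := P - C (c * (-A / 2 : ℝ)) * W n lam)
    ((natDegree_sub_le _ _).trans (max_le hP ((natDegree_C_mul_le _ _).trans
      (natDegree_W_le n lam)))) (fun k hk => by
    rw [← trig_eq_zero_iff (n := n), trig_sub, trig_C_mul, hr, trig_W]
    have := hAk k (Finset.mem_Icc.mp hk).1 (Finset.mem_Icc.mp hk).2
    simp only [hξ] at this
    rw [this]; push_cast; ring)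
  -- The quotient is `c` times a real number, as is seen at a point where `q` does not vanish.
  obtain ⟨t, ht⟩ : ∃ t, q t ≠ 0 := by
    by_contra! h
    refine hsimple 1 (by simp [hn]) ?_
    rw [show q = fun _ => (0 : ℝ) from funext h]; simp
  have hBt : trig n (P - C (c * (-A / 2 : ℝ)) * W n lam) t = trig n (C B * Q n lam) t := by rw [hB]
  rw [trig_sub, trig_C_mul, trig_C_mul, hr, trig_W, trig_Q] at hBt
  have hBr : B = c * ((r t - A * deriv q t) / q t : ℝ) := by
    have ht' : (q t : ℂ) ≠ 0 := by exact_mod_cast ht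
    rw [← hq] at hBt
    rw [← mul_right_inj' ht', mul_comm, ← hBt]
    push_cast
    field_simp
  refine ⟨-A / 2, (r t - A * deriv q t) / q t, ?_⟩
  rw [sub_eq_iff_eq_add] at hB
  rw [hB, hBr]
  simp only [C_mul]
  ring

/-- The sign of the cross expression at `0` determines the sign of the coefficient of `W`. -/
theorem DBar.mul_im_nonpos {n : ℕ} (hn : 1 ≤ n) {lam : ℝ}
    (hlam : lam ∈ Set.Ioo (0 : ℝ) (2 * Real.pi / n)) {c : ℂ} {a b : ℝ}
    (hF : C c * (C (b : ℂ) * Q n lam + C (a : ℂ) * W n lam) - Q n lam ∈ DBar n lam) :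
    a * c.im ≤ 0 := by
  have h := DBar.cross_nonneg
    (r := fun t => b * cosProd n lam t + a * (-2 * deriv (cosProd n lam) t)) (fun t => by
      rw [trig_C_mul, trig_add, trig_C_mul, trig_C_mul, trig_Q, trig_W]; push_cast; ring) hF 0
  obtain ⟨m, rfl⟩ : ∃ m, n = m + 1 := ⟨n - 1, by omega⟩
  have hw := cosProd_wronskian m lam 0
  have hpos := prod_cosFactor_zero_pos hlam
  have hs : 0 < Real.sin ((m + 1 : ℝ) * lam / 2) :=
    sin_half_pos hn hlam (by positivity) (by push_cast; rfl)
  -- With `r = b q - 2 a q'` the cross expression is `2 a` times the Wronskian of the two shifts.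
  set p := ∏ i ∈ Finset.range m, cosFactor (m + 1) lam (i + 1) 0
  have h2 : c.im * a * (2 * (-2 * Real.sin ((m + 1 : ℝ) * lam / 2) * p ^ 2)) ≥ 0 := by
    rw [← hw]; refine h.trans_eq ?_; ring
  have h3 : 0 < 4 * Real.sin ((m + 1 : ℝ) * lam / 2) * p ^ 2 := by positivity
  by_contra! hneg
  nlinarith [mul_pos hneg h3]

/-! ### Members of `DBar` whose phase is real -/

/-- The reverse of the conjugated polynomial takes the value `w ^ n * conj (F (1 / conj w))`. -/
theorem eval_reverse_map_conj {n : ℕ} {F : ℂ[X]} (hdeg : F.degree = (n : WithBot ℕ)) {w : ℂ}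
    (hw : w ≠ 0) : (F.map (starRingEnd ℂ)).reverse.eval w =
      w ^ n * (starRingEnd ℂ) (F.eval ((starRingEnd ℂ) w)⁻¹) := by
  have hGdeg : (F.map (starRingEnd ℂ)).natDegree = n := by
    rw [natDegree_map, natDegree_eq_of_degree_eq_some hdeg]
  let _ : Invertible w⁻¹ := invertibleOfNonzero (inv_ne_zero hw)
  have h := eval₂_reverse_mul_pow (RingHom.id ℂ) w⁻¹ (F.map (starRingEnd ℂ))
  rw [hGdeg] at h
  simp only [invOf_eq_inv, inv_inv, ← eval_map, Polynomial.map_id] at h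
  have h2 : (F.map (starRingEnd ℂ)).eval w⁻¹ =
      (starRingEnd ℂ) (F.eval ((starRingEnd ℂ) w)⁻¹) := by
    have := eval_map_apply (p := F) (starRingEnd ℂ) ((starRingEnd ℂ) w)⁻¹
    simpa using this
  rw [← h2, ← h, mul_comm, mul_assoc, ← mul_pow, inv_mul_cancel₀ hw, one_pow, mul_one]

/-- A polynomial of degree `n` whose normalization is `c` times a real function is
self-inversive. -/
theorem eq_C_mul_reverse_of_real {n : ℕ} {F : ℂ[X]} (hdeg : F.degree = (n : WithBot ℕ)) {c : ℂ}
    {r : ℝ → ℝ} (hc : ‖c‖ = 1) (hr : ∀ t, trig n F t = c * r t) :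
    F = C (c ^ 2) * (F.map (starRingEnd ℂ)).reverse := by
  refine eq_of_infinite_eval_eq _ _ (Set.infinite_of_injOn_mapsTo (f := cis)
    (s := Set.Icc (-(Real.pi / 2)) (Real.pi / 2)) (fun s hs t ht hst => ?_) (fun t _ => ?_)
    (Set.Icc_infinite (by linarith [Real.pi_pos])))
  · exact Real.injOn_sin hs ht (by simpa using congrArg Complex.im hst)
  · have h1 : ((starRingEnd ℂ) (cis t))⁻¹ = cis t := by
      rw [conj_cis]
      exact inv_eq_of_mul_eq_one_right (cis_neg_mul t)
    have h2 : F.eval (cis t) = cis (n * t / 2) * (c * r t) := by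
      rw [← hr, trig, ← mul_assoc, mul_comm (cis _), cis_neg_mul, one_mul]
    have h3 : cis t ^ n = cis (n * t / 2) * cis (n * t / 2) := by
      rw [← cis_nat_mul, ← cis_add]; ring_nf
    have h4 : c * (starRingEnd ℂ) c = 1 := by
      rw [Complex.mul_conj, Complex.normSq_eq_norm_sq, hc]; simp
    have h5 := cis_neg_mul (n * t / 2)
    rw [Set.mem_ofPred_eq, eval_mul, eval_C, eval_reverse_map_conj hdeg (cis_ne_zero t), h1, h2, h3]
    simp only [map_mul, conj_cis, Complex.conj_ofReal]
    linear_combination (-c * r t * cis (n * t / 2)) * h4 -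
      (c ^ 2 * (starRingEnd ℂ) c * r t * cis (n * t / 2)) * h5

theorem eval_zero_ne_zero_of_real {n : ℕ} {F : ℂ[X]} (hdeg : F.degree = (n : WithBot ℕ)) {c : ℂ}
    {r : ℝ → ℝ} (hc : ‖c‖ = 1) (hr : ∀ t, trig n F t = c * r t) : F.eval 0 ≠ 0 := by
  have hc0 : c ≠ 0 := norm_ne_zero_iff.mp (by rw [hc]; exact one_ne_zero)
  have hF0 : F ≠ 0 := by rintro rfl; simp at hdeg
  rw [eq_C_mul_reverse_of_real hdeg hc hr, eval_mul, eval_C, ← coeff_zero_eq_eval_zero,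
    coeff_zero_reverse, leadingCoeff_map]
  simpa [hc0] using hF0

theorem eval_inv_conj_eq_zero_of_real {n : ℕ} {F : ℂ[X]} (hdeg : F.degree = (n : WithBot ℕ)) {c : ℂ}
    {r : ℝ → ℝ} (hc : ‖c‖ = 1) (hr : ∀ t, trig n F t = c * r t) {z : ℂ} (hz0 : z ≠ 0)
    (hz : F.eval z = 0) : F.eval ((starRingEnd ℂ) z)⁻¹ = 0 := by
  rw [eq_C_mul_reverse_of_real hdeg hc hr, eval_mul, eval_C, eval_reverse_map_conj hdeg hz0] at hz
  have hc0 : c ≠ 0 := norm_ne_zero_iff.mp (by rw [hc]; exact one_ne_zero)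
  simpa [hc0, hz0] using hz

theorem DBar.mem_piClass_closedBall {n : ℕ} {lam : ℝ} {F : ℂ[X]} (hF : F ∈ DBar n lam) :
    F ∈ piClass n (Metric.closedBall 0 1) := by
  refine ⟨hF.1, fun z hz => ?_⟩
  rw [mem_closedBall_zero_iff]
  by_contra! h
  have h2 := hF.2 (cis (lam / 2) * z) (by simpa using h)
  have h3 : cis (-lam / 2) * (cis (lam / 2) * z) = z := by
    rw [← mul_assoc, ← cis_add, show -lam / 2 + lam / 2 = 0 by ring, cis_zero, one_mul]
  rw [eval_minus, h3, hz.eq_zero] at h2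
  simp at h2

/-- The zeros of a self-inversive polynomial are symmetric about the unit circle. -/
theorem mem_piClass_sphere_of_real {n : ℕ} {F : ℂ[X]}
    (hF : F ∈ piClass n (Metric.closedBall 0 1)) {c : ℂ} {r : ℝ → ℝ}
    (hc : ‖c‖ = 1) (hr : ∀ t, trig n F t = c * r t) :
    F ∈ piClass n (Metric.sphere 0 1) := by
  refine ⟨hF.1, fun z hz => ?_⟩
  have hz0 : z ≠ 0 := by
    rintro rfl
    exact eval_zero_ne_zero_of_real hF.1 hc hr hz
  have h1 : ‖z‖ ≤ 1 := by simpa using hF.2 z hz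
  have h2 : ‖z‖⁻¹ ≤ 1 := by
    simpa using hF.2 _ (eval_inv_conj_eq_zero_of_real hF.1 hc hr hz0 hz)
  rw [mem_sphere_zero_iff_norm]
  exact le_antisymm h1 ((inv_le_one₀ (norm_pos_iff.mpr hz0)).mp h2)

/-- With `z = 1 / u`, a zero `ζ` of `F` contributes the factor `mob lam (ζ u)` to the quotient
`e^{-inλ/2} F(e^{iλ/2} z) / F(e^{-iλ/2} z)`. -/
def mob (lam : ℝ) (v : ℂ) : ℂ := (1 - cis (-lam / 2) * v) / (cis (-lam / 2) - v)

theorem cis_sub_ne_zero (x : ℝ) {v : ℂ} (hv : ‖v‖ < 1) : cis x - v ≠ 0 := by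
  intro h
  rw [← sub_eq_zero.mp h, norm_cis] at hv
  exact lt_irrefl _ hv

theorem mob_im_pos {lam : ℝ} (hlam : 0 < lam) (hlam' : lam < 2 * Real.pi) {v : ℂ} (hv : ‖v‖ < 1) :
    0 < (mob lam v).im := by
  rw [mob, im_div_eq]
  refine div_pos ?_ (Complex.normSq_pos.mpr (cis_sub_ne_zero _ hv))
  have hs : 0 < Real.sin (lam / 2) := Real.sin_pos_of_pos_of_lt_pi (by linarith) (by linarith)
  have hv2 : v.re ^ 2 + v.im ^ 2 < 1 := by
    have h := Complex.sq_norm v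
    rw [Complex.normSq_apply] at h
    nlinarith [norm_nonneg v]
  have h1 := Real.sin_sq_add_cos_sq (lam / 2)
  have e : ((1 - cis (-lam / 2) * v) * (starRingEnd ℂ) (cis (-lam / 2) - v)).im =
      Real.sin (lam / 2) * (1 - (v.re ^ 2 + v.im ^ 2)) := by
    simp only [neg_div, cis_eq, Real.cos_neg, Real.sin_neg, Complex.mul_im, Complex.mul_re,
      Complex.conj_re, Complex.conj_im, Complex.sub_re, Complex.sub_im, Complex.add_re,
      Complex.add_im, Complex.ofReal_re, Complex.ofReal_im, Complex.I_re, Complex.I_im,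
      Complex.one_re, Complex.one_im]
    linear_combination (-v.im) * h1
  rw [e]
  exact mul_pos hs (by linarith)

theorem mob_zero (lam : ℝ) : mob lam 0 = cis (lam / 2) := by
  have h := cis_neg_mul (lam / 2)
  rw [mob, mul_zero, sub_zero, sub_zero, neg_div, one_div]
  exact (eq_inv_of_mul_eq_one_right h).symm

theorem continuousAt_mob {lam : ℝ} {v : ℂ} (hv : cis (-lam / 2) - v ≠ 0) :
    ContinuousAt (mob lam) v := by
  unfold mob
  exact ContinuousAt.div (by fun_prop) (by fun_prop) hv

/-- On the arc of half-width `λ/2` about `1`, `mob lam` takes negative real values. -/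
theorem mob_cis {lam φ : ℝ} (hlam : lam < 2 * Real.pi) (h : |φ| < lam / 2) :
    (mob lam (cis φ)).re < 0 ∧ (mob lam (cis φ)).im = 0 ∧ cis (-lam / 2) - cis φ ≠ 0 := by
  obtain ⟨h1, h2⟩ := abs_lt.mp h
  have hs1 : 0 < Real.sin ((lam / 2 - φ) / 2) :=
    Real.sin_pos_of_pos_of_lt_pi (by linarith) (by linarith)
  have hs2 : 0 < Real.sin ((lam / 2 + φ) / 2) :=
    Real.sin_pos_of_pos_of_lt_pi (by linarith) (by linarith)
  have e1 : 1 - cis (-lam / 2) * cis φ = cis ((φ - lam / 2) / 2) *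
      (2 * Real.sin ((lam / 2 - φ) / 2) : ℝ) * Complex.I := by
    rw [← cis_add, ← cis_zero, cis_sub_cis]; ring_nf
  have e2 : cis (-lam / 2) - cis φ = cis ((φ - lam / 2) / 2) *
      (-(2 * Real.sin ((lam / 2 + φ) / 2)) : ℝ) * Complex.I := by
    rw [cis_sub_cis, ← mul_neg, ← Real.sin_neg]; ring_nf
  have hne : cis (-lam / 2) - cis φ ≠ 0 := by
    rw [e2]
    refine mul_ne_zero (mul_ne_zero (cis_ne_zero _) ?_) Complex.I_ne_zero
    exact_mod_cast (neg_lt_zero.mpr (mul_pos two_pos hs2)).ne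
  have e3 : mob lam (cis φ) =
      (-(Real.sin ((lam / 2 - φ) / 2) / Real.sin ((lam / 2 + φ) / 2)) : ℝ) := by
    rw [mob, div_eq_iff hne, e1, e2]
    have : (Real.sin ((lam / 2 + φ) / 2) : ℂ) ≠ 0 := by exact_mod_cast hs2.ne'
    push_cast [-Complex.ofReal_sin]
    generalize (Real.sin ((lam / 2 + φ) / 2) : ℂ) = S at this ⊢
    field_simp
  rw [e3]
  exact ⟨by rw [Complex.ofReal_re]; exact neg_lt_zero.mpr (div_pos hs1 hs2),
    Complex.ofReal_im _, hne⟩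

theorem list_prod_eq_norm_mul_cis (l : List ℂ) :
    l.prod = (l.map fun z => ‖z‖).prod * cis (l.map Complex.arg).sum := by
  induction l with
  | nil => simp
  | cons z l ih =>
    simp only [List.prod_cons, List.map_cons, List.sum_cons, cis_add, Complex.ofReal_mul]
    rw [ih]
    nth_rewrite 1 [← Complex.norm_mul_exp_arg_mul_I z]
    simp only [cis]
    ring

theorem pow_length_mul_prod_div_prod {l : List ℂ} (e : ℂ) {f g h : ℂ → ℂ}
    (H : ∀ ζ ∈ l, e * (f ζ / g ζ) = h ζ) :
    e ^ l.length * ((l.map f).prod / (l.map g).prod) = (l.map h).prod := by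
  induction l with
  | nil => simp
  | cons z l ih =>
    simp only [List.length_cons, List.map_cons, List.prod_cons]
    rw [← H z List.mem_cons_self, ← ih fun ζ hζ => H ζ (List.mem_cons_of_mem _ hζ), pow_succ,
      mul_div_mul_comm]
    ring

theorem eval_eq_list_prod {F : ℂ[X]} {l : List ℂ} (hl : F.roots = l) (z : ℂ) :
    F.eval z = F.leadingCoeff * (l.map fun ζ => z - ζ).prod := by
  conv_lhs => rw [(IsAlgClosed.splits F).eq_prod_roots]
  rw [hl, eval_mul, eval_C, eval_multiset_prod]
  simp [Function.comp_def]

/-- Along each ray the sum of the arguments of the factors stays below `π`: it starts at `nλ/2`, and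
could equal `π` only where the quotient in the definition of `DBar` is real. -/
theorem DBar.sum_arg_lt {n : ℕ} (hn : 1 ≤ n) {lam : ℝ}
    (hlam : lam ∈ Set.Ioo (0 : ℝ) (2 * Real.pi / n)) {F : ℂ[X]} (hF : F ∈ DBar n lam)
    {l : List ℂ} (hl : F.roots = l) (hnorm : ∀ ζ ∈ l, ‖ζ‖ = 1) {u₀ : ℂ} (hu : ‖u₀‖ = 1)
    {s : ℝ} (hs : s ∈ Set.Ico (0 : ℝ) 1) :
    (l.map fun ζ => (mob lam (ζ * (s * u₀))).arg).sum < Real.pi := by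
  have hn' : (0 : ℝ) < n := by exact_mod_cast hn
  have hlam2 : lam * n < 2 * Real.pi := (lt_div_iff₀ hn').mp hlam.2
  have hlam3 : lam < 2 * Real.pi := by
    have : (1 : ℝ) ≤ n := by exact_mod_cast hn
    nlinarith [hlam.1]
  have hlen : l.length = n := by
    rw [← Multiset.coe_card, ← hl, ← (IsAlgClosed.splits F).natDegree_eq_card_roots]
    exact natDegree_eq_of_degree_eq_some hF.1
  have hlt : ∀ ζ ∈ l, ∀ x ∈ Set.Ico (0 : ℝ) 1, ‖ζ * (x * u₀)‖ < 1 := by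
    intro ζ hζ x hx
    simpa [hnorm ζ hζ, hu, abs_of_nonneg hx.1] using hx.2
  set A : ℝ → ℝ := fun x => (l.map fun ζ => (mob lam (ζ * (x * u₀))).arg).sum with hA
  have hcont : ContinuousOn A (Set.Icc 0 s) := by
    refine continuousOn_list_sum l fun ζ hζ x hx => ?_
    have hx1 : ‖ζ * (x * u₀)‖ < 1 := hlt ζ hζ x ⟨hx.1, hx.2.trans_lt hs.2⟩
    refine ContinuousAt.continuousWithinAt ?_
    have h1 : ContinuousAt (fun x : ℝ => ζ * (x * u₀)) x := by fun_prop
    have h2 : ContinuousAt (fun x : ℝ => mob lam (ζ * (x * u₀))) x :=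
      ContinuousAt.comp (g := mob lam) (continuousAt_mob (cis_sub_ne_zero _ hx1)) h1
    exact ContinuousAt.comp (g := Complex.arg) (Complex.continuousAt_arg
      (Complex.mem_slitPlane_iff.mpr (.inr (mob_im_pos hlam.1 hlam3 hx1).ne'))) h2
  have hA0 : A 0 < Real.pi := by
    have : (cis (lam / 2)).arg = lam / 2 := by
      rw [cis, Complex.arg_exp_mul_I, toIocMod_eq_self]
      constructor <;> linarith [hlam.1, Real.pi_pos]
    simp only [hA, Complex.ofReal_zero, zero_mul, mul_zero, mob_zero, this, List.map_const',
      List.sum_replicate, hlen, nsmul_eq_mul]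
    linarith
  by_contra! hge
  obtain ⟨x, hx, hxA⟩ := intermediate_value_Icc hs.1 hcont ⟨hA0.le, hge⟩
  have hx0 : x ≠ 0 := by rintro rfl; exact hA0.ne hxA
  have hxpos : 0 < x := lt_of_le_of_ne hx.1 hx0.symm
  have hx1 : x < 1 := hx.2.trans_lt hs.2
  have hu0 : u₀ ≠ 0 := norm_ne_zero_iff.mp (by rw [hu]; exact one_ne_zero)
  have hxu : (x : ℂ) * u₀ ≠ 0 := mul_ne_zero (by exact_mod_cast hx0) hu0
  have hD := hF.2 ((x : ℂ) * u₀)⁻¹ (by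
    rw [norm_inv, norm_mul, hu, mul_one, Complex.norm_real, Real.norm_of_nonneg hx.1]
    exact (one_lt_inv₀ hxpos).mpr hx1)
  have hF0 : F.leadingCoeff ≠ 0 := leadingCoeff_ne_zero.mpr (by
    rintro rfl
    simpa using hF.1)
  have hprod : cis (-((n : ℝ) * lam / 2)) * ((plus lam F).eval ((x : ℂ) * u₀)⁻¹ /
      (minus lam F).eval ((x : ℂ) * u₀)⁻¹) = (l.map fun ζ => mob lam (ζ * (x * u₀))).prod := by
    rw [eval_plus, eval_minus, eval_eq_list_prod hl, eval_eq_list_prod hl,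
      mul_div_mul_left _ _ hF0, show -((n : ℝ) * lam / 2) = (n : ℕ) * (-lam / 2) by ring,
      cis_nat_mul, ← hlen]
    refine pow_length_mul_prod_div_prod _ fun ζ hζ => ?_
    have hm := cis_neg_mul (lam / 2)
    have h1 := cis_sub_ne_zero (-lam / 2) (hlt ζ hζ x ⟨hx.1, hx1⟩)
    have h2 : cis (-lam / 2) * ((x : ℂ) * u₀)⁻¹ - ζ =
        (cis (-lam / 2) - ζ * (x * u₀)) * ((x : ℂ) * u₀)⁻¹ := by
      rw [sub_mul, mul_assoc ζ, mul_inv_cancel₀ hxu, mul_one]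
    have h3 : cis (-lam / 2) * (cis (lam / 2) * ((x : ℂ) * u₀)⁻¹ - ζ) =
        (1 - cis (-lam / 2) * (ζ * (x * u₀))) * ((x : ℂ) * u₀)⁻¹ := by
      rw [← neg_div] at hm
      rw [sub_mul, one_mul, mul_assoc (cis _), mul_assoc ζ, mul_inv_cancel₀ hxu, mul_one, mul_sub,
        ← mul_assoc, hm, one_mul]
    rw [← mul_div_assoc, h3, h2, mul_div_mul_right _ _ (inv_ne_zero hxu), mob]
  rw [hprod, list_prod_eq_norm_mul_cis, List.map_map, List.map_map] at hD
  have hsum : (l.map (Complex.arg ∘ fun ζ => mob lam (ζ * (x * u₀)))).sum = Real.pi := hxA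
  rw [hsum, Complex.im_ofReal_mul, cis_im, Real.sin_pi, mul_zero] at hD
  exact lt_irrefl _ hD

/-- A member of `DBar` that is a unimodular multiple of a real function on the circle belongs to
`TBar`: for two zeros closer than `λ`, both arguments tend to `π` along the ray towards the
midpoint of the zeros, whereas the sum of all arguments, each of them positive, is below `π`. -/
theorem DBar.mem_TBar_of_real {n : ℕ} (hn : 1 ≤ n) {lam : ℝ}
    (hlam : lam ∈ Set.Ioo (0 : ℝ) (2 * Real.pi / n)) {F : ℂ[X]} (hF : F ∈ DBar n lam)
    {c : ℂ} {r : ℝ → ℝ} (hc : ‖c‖ = 1) (hr : ∀ t, trig n F t = c * r t) :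
    F ∈ TBar n lam := by
  have hS := mem_piClass_sphere_of_real (DBar.mem_piClass_closedBall hF) hc hr
  refine ⟨hS, ?_⟩
  have hlam3 : lam < 2 * Real.pi := by
    have h1 : (1 : ℝ) ≤ n := by exact_mod_cast hn
    have := (lt_div_iff₀ (by linarith)).mp hlam.2
    nlinarith [hlam.1]
  have hl : F.roots = (F.roots.toList : Multiset ℂ) := (Multiset.coe_toList _).symm
  set l := F.roots.toList with hldef
  have hnorm : ∀ ζ ∈ l, ‖ζ‖ = 1 := fun ζ hζ => by
    simpa using hS.2 ζ (isRoot_of_mem_roots (Multiset.mem_toList.mp hζ))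
  refine ⟨l, hl, List.pairwise_iff_forall_sublist.mpr fun {ζ₁ ζ₂} hsub => ?_⟩
  by_contra! hlt
  have hn1 : ‖ζ₁‖ = 1 := hnorm _ (hsub.subset (by simp))
  have hn2 : ‖ζ₂‖ = 1 := hnorm _ (hsub.subset (by simp))
  have hne1 : ζ₁ ≠ 0 := norm_ne_zero_iff.mp (by rw [hn1]; exact one_ne_zero)
  have hne2 : ζ₂ ≠ 0 := norm_ne_zero_iff.mp (by rw [hn2]; exact one_ne_zero)
  rw [Complex.angle_eq_abs_arg hne1 hne2] at hlt
  set δ := (ζ₁ / ζ₂).arg with hδ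
  have hcis : cis δ = ζ₁ / ζ₂ := cis_arg (by rw [norm_div, hn1, hn2, div_one])
  -- The reciprocal of the midpoint of the two zeros.
  set u₀ : ℂ := ζ₂⁻¹ * cis (-(δ / 2)) with hu₀
  have hu : ‖u₀‖ = 1 := by simp [hu₀, hn2]
  have e2 : ζ₂ * u₀ = cis (-(δ / 2)) := by rw [hu₀, ← mul_assoc, mul_inv_cancel₀ hne2, one_mul]
  have e1 : ζ₁ * u₀ = cis (δ / 2) := by
    rw [hu₀, ← mul_assoc, ← div_eq_mul_inv, ← hcis, ← cis_add]; ring_nf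
  have hlim : ∀ ζ ∈ l, ∀ φ : ℝ, |φ| < lam / 2 → ζ * u₀ = cis φ →
      Tendsto (fun s : ℝ => (mob lam (ζ * (s * u₀))).arg) (𝓝[<] 1) (𝓝 Real.pi) := by
    intro ζ hζ φ hφ hζφ
    obtain ⟨hre, him, hd⟩ := mob_cis hlam3 hφ
    refine (Complex.tendsto_arg_nhdsWithin_im_nonneg_of_re_neg_of_im_zero hre him).comp ?_
    refine tendsto_nhdsWithin_iff.mpr ⟨?_, ?_⟩
    · have h1 : Tendsto (fun s : ℝ => ζ * (s * u₀)) (𝓝[<] 1) (𝓝 (cis φ)) := by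
        have hc : Continuous fun s : ℝ => ζ * (s * u₀) := by fun_prop
        have := hc.tendsto 1
        rw [Complex.ofReal_one, one_mul, hζφ] at this
        exact this.mono_left nhdsWithin_le_nhds
      exact (continuousAt_mob hd).tendsto.comp h1
    · filter_upwards [Ioo_mem_nhdsLT (zero_lt_one' ℝ)] with s hs
      refine (mob_im_pos hlam.1 hlam3 ?_).le
      simpa [hnorm ζ hζ, hu, abs_of_nonneg hs.1.le] using hs.2
  have hhalf : |δ / 2| < lam / 2 := by rw [abs_div, abs_two]; linarith
  have hsum := (hlim ζ₁ (hsub.subset (by simp)) _ hhalf e1).add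
    (hlim ζ₂ (hsub.subset (by simp)) _ (by rwa [abs_neg]) e2)
  have hle : Real.pi + Real.pi ≤ Real.pi := by
    refine le_of_tendsto hsum ?_
    filter_upwards [Ioo_mem_nhdsLT (zero_lt_one' ℝ)] with s hs
    have h1 := DBar.sum_arg_lt hn hlam hF hl hnorm hu ⟨hs.1.le, hs.2⟩
    have h2 := (hsub.map fun ζ => (mob lam (ζ * (s * u₀))).arg).sum_le_sum (by
      intro a ha
      obtain ⟨ζ, hζ, rfl⟩ := List.mem_map.mp ha
      refine Complex.arg_nonneg_iff.mpr (mob_im_pos hlam.1 hlam3 ?_).le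
      simpa [hnorm ζ hζ, hu, abs_of_nonneg hs.1.le] using hs.2)
    simp only [List.map_cons, List.map_nil, List.sum_cons, List.sum_nil, add_zero] at h2
    linarith
  linarith [Real.pi_pos]

/-! ### The quotient `W / Q` as a sum of Cayley transforms -/

/-- The Cayley transform `-i (v - 1) / (v + 1)`, equal to `tan (t / 2)` at `v = e^{it}`. It maps the
open unit disk to the upper half-plane and the exterior of the closed disk to the lower one. -/
def cay (v : ℂ) : ℂ := -Complex.I * (v - 1) / (1 + v)

theorem cay_im (v : ℂ) : (cay v).im = (1 - ‖v‖ ^ 2) / Complex.normSq (1 + v) := by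
  rw [cay, im_div_eq, Complex.sq_norm, Complex.normSq_apply v]
  congr 1
  simp [Complex.mul_im]
  ring

theorem one_add_ne_zero {v : ℂ} (hv : ‖v‖ ≠ 1) : 1 + v ≠ 0 := by
  intro h
  rw [← neg_eq_of_add_eq_zero_right h] at hv
  simp at hv

theorem cay_im_neg {v : ℂ} (hv : 1 < ‖v‖) : (cay v).im < 0 := by
  rw [cay_im]
  exact div_neg_of_neg_of_pos (by nlinarith) (Complex.normSq_pos.mpr (one_add_ne_zero hv.ne'))

theorem cay_im_pos {v : ℂ} (hv : ‖v‖ < 1) : 0 < (cay v).im := by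
  rw [cay_im]
  exact div_pos (by nlinarith [norm_nonneg v]) (Complex.normSq_pos.mpr (one_add_ne_zero hv.ne))

theorem mul_eval_derivative_prod {ι : Type*} (s : Finset ι) (e : ι → ℂ) (z : ℂ)
    (h : ∀ k ∈ s, 1 + e k * z ≠ 0) :
    z * (derivative (∏ k ∈ s, (1 + C (e k) * X))).eval z =
      (∏ k ∈ s, (1 + e k * z)) * ∑ k ∈ s, e k * z / (1 + e k * z) := by
  classical
  induction s using Finset.induction_on with
  | empty => simp
  | insert k s hk ih =>
    have hk0 := h k (Finset.mem_insert_self _ _)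
    have ih' := ih fun l hl => h l (Finset.mem_insert_of_mem hl)
    rw [Finset.prod_insert hk, Finset.prod_insert hk, Finset.sum_insert hk, derivative_mul,
      eval_add, eval_mul, eval_mul, mul_add, mul_left_comm z (eval z (1 + C (e k) * X)), ih']
    simp only [derivative_add, derivative_one, derivative_C_mul, derivative_X, eval_add, eval_mul,
      eval_C, eval_X, eval_one, eval_prod, mul_one, zero_add]
    have := mul_div_cancel₀ (e k * z) hk0
    linear_combination (-∏ l ∈ s, (1 + e l * z)) * this

theorem eval_W {n : ℕ} {lam : ℝ} {z : ℂ}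
    (h : ∀ k ∈ Finset.Icc 1 n, 1 + cis (beta n lam k) * z ≠ 0) :
    (W n lam).eval z = (Q n lam).eval z * ∑ k ∈ Finset.Icc 1 n, cay (cis (beta n lam k) * z) := by
  have h1 := mul_eval_derivative_prod (Finset.Icc 1 n) (fun k => cis (beta n lam k)) z h
  rw [← Q_eq, ← eval_Q] at h1
  have h2 : ∑ k ∈ Finset.Icc 1 n, cay (cis (beta n lam k) * z) =
      -Complex.I * (2 * ∑ k ∈ Finset.Icc 1 n, cis (beta n lam k) * z / (1 + cis (beta n lam k) * z)
        - n) := by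
    have hn : (n : ℂ) = ∑ k ∈ Finset.Icc 1 n, (1 : ℂ) := by simp
    rw [hn, Finset.mul_sum, ← Finset.sum_sub_distrib, Finset.mul_sum]
    refine Finset.sum_congr rfl fun k hk => ?_
    have := h k hk
    rw [cay]
    field_simp
    ring
  rw [h2, W]
  simp only [eval_mul, eval_sub, eval_C, eval_X, eval_ofNat]
  linear_combination (-2 * Complex.I) * h1

/-- The real constant by which the bracket of `HasForm` differs from `b + a W / Q`. -/
def cotSum (n : ℕ) (lam : ℝ) : ℝ :=
  ∑ k ∈ Finset.Icc 1 n, Real.cos (((k : ℝ) - n - 1) * lam / 2) /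
    Real.sin (((k : ℝ) - n - 1) * lam / 2)

theorem form_sum_eq {n : ℕ} {lam : ℝ} (hlam : lam ∈ Set.Ioo (0 : ℝ) (2 * Real.pi / n)) {z : ℂ}
    (h : ∀ k ∈ Finset.Icc 1 n, 1 + cis (beta n lam k) * z ≠ 0) :
    ∑ k ∈ Finset.Icc 1 n,
        cis (((k : ℝ) - n - 1) * lam / 2) / (Real.sin (((k : ℝ) - n - 1) * lam / 2) : ℂ) *
          ((1 + cis (((n : ℝ) + 1) * lam / 2) * z) / (1 + cis (beta n lam k) * z)) =
      cotSum n lam + ∑ k ∈ Finset.Icc 1 n, cay (cis (beta n lam k) * z) := by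
  rw [cotSum, Complex.ofReal_sum, ← Finset.sum_add_distrib]
  refine Finset.sum_congr rfl fun k hk => ?_
  have hk' := Finset.mem_Icc.mp hk
  have hkn : (k : ℝ) ≤ n := by exact_mod_cast hk'.2
  have hk1 : (1 : ℝ) ≤ k := by exact_mod_cast hk'.1
  set x : ℝ := ((k : ℝ) - n - 1) * lam / 2 with hx
  have hs : (Real.sin x : ℂ) ≠ 0 := by
    have h1 := sin_half_pos (x := (n : ℝ) + 1 - k) (hk'.1.trans hk'.2) hlam (by linarith)
      (by linarith)
    rw [show ((n : ℝ) + 1 - k) * lam / 2 = -x by rw [hx]; ring, Real.sin_neg] at h1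
    exact_mod_cast (neg_pos.mp h1).ne
  have hv := h k hk
  have e1 : cis x * cis (((n : ℝ) + 1) * lam / 2) = cis (-x) * cis (beta n lam k) := by
    rw [← cis_add, ← cis_add, hx, beta]; ring_nf
  have e2 : cis x = Real.cos x + Real.sin x * Complex.I := cis_eq x
  have e3 : cis (-x) = Real.cos x - Real.sin x * Complex.I := by
    rw [cis_eq, Real.cos_neg, Real.sin_neg]; push_cast; ring
  rw [e3] at e1
  rw [cay, Complex.ofReal_div, div_mul_div_comm, div_add_div _ _ hs hv]
  congr 1
  linear_combination z * e1 + e2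

theorem hasForm_iff {n : ℕ} {lam : ℝ} (hlam : lam ∈ Set.Ioo (0 : ℝ) (2 * Real.pi / n)) (P : ℂ[X])
    (c : ℂ) (a b : ℝ) : HasForm n lam P c a b ↔
      P = C c * (C ((b + a * cotSum n lam : ℝ) : ℂ) * Q n lam + C (a : ℂ) * W n lam) := by
  have key : ∀ z : ℂ, (∀ k ∈ Finset.Icc 1 n, 1 + cis (beta n lam k) * z ≠ 0) →
      c * ((b : ℂ) + (a : ℂ) * ∑ k ∈ Finset.Icc 1 n,
        cis (((k : ℝ) - n - 1) * lam / 2) / (Real.sin (((k : ℝ) - n - 1) * lam / 2) : ℂ) *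
          ((1 + cis (((n : ℝ) + 1) * lam / 2) * z) / (1 + cis (beta n lam k) * z))) *
      (Q n lam).eval z =
      (C c * (C ((b + a * cotSum n lam : ℝ) : ℂ) * Q n lam + C (a : ℂ) * W n lam)).eval z := by
    intro z hz
    rw [form_sum_eq hlam hz]
    simp only [eval_mul, eval_add, eval_C]
    rw [eval_W hz]
    push_cast
    ring
  constructor
  · intro h
    refine mul_right_cancel₀ (Q_ne_zero n lam) (Polynomial.funext fun z => ?_)
    rw [eval_mul, eval_mul]
    by_cases hz : (Q n lam).eval z = 0
    · rw [hz, mul_zero, mul_zero]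
    · have hz' : ∀ k ∈ Finset.Icc 1 n, 1 + cis (beta n lam k) * z ≠ 0 := by
        rw [eval_Q] at hz
        exact Finset.prod_ne_zero_iff.mp hz
      rw [h z hz', ← key z hz']
      rfl
  · intro h z hz
    rw [h, ← key z hz]
    rfl

/-! ### Zeros of the combinations of `Q` and `W` -/

theorem eq_conj_of_mul_eq_one {c w : ℂ} (hc : ‖c‖ = 1) (h : c * w = 1) :
    w = (starRingEnd ℂ) c := by
  have h1 : c * (starRingEnd ℂ) c = 1 := by
    rw [Complex.mul_conj, Complex.normSq_eq_norm_sq, hc]; simp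
  have hc0 : c ≠ 0 := norm_ne_zero_iff.mp (by rw [hc]; exact one_ne_zero)
  exact mul_left_cancel₀ hc0 (h.trans h1.symm)

/-- On the circle `Q` and `W` normalize to the real functions `q` and `-2 q'`, so a zero of the
combination would be a common zero of `q` and `q'`. -/
theorem combination_circle_ne_zero {n : ℕ} {lam : ℝ}
    (hlam : lam ∈ Set.Ioo (0 : ℝ) (2 * Real.pi / n)) {c : ℂ} (him : c.im ≠ 0) {a b : ℝ}
    (ha : a ≠ 0) {z : ℂ} (hz : ‖z‖ = 1) :
    (C c * (C (b : ℂ) * Q n lam + C (a : ℂ) * W n lam) - Q n lam).eval z ≠ 0 := by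
  rw [← cis_arg hz]
  intro h
  rw [← trig_eq_zero_iff (n := n), trig_sub, trig_C_mul, trig_add, trig_C_mul, trig_C_mul, trig_Q,
    trig_W] at h
  set q := cosProd n lam z.arg with hq
  set q' := deriv (cosProd n lam) z.arg with hq'
  have h1 := congrArg Complex.im h
  have h2 := congrArg Complex.re h
  rw [← Complex.ofReal_mul, ← Complex.ofReal_mul, ← Complex.ofReal_add, Complex.sub_im,
    Complex.im_mul_ofReal, Complex.ofReal_im, sub_zero, Complex.zero_im] at h1
  rw [← Complex.ofReal_mul, ← Complex.ofReal_mul, ← Complex.ofReal_add, Complex.sub_re,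
    Complex.re_mul_ofReal, Complex.ofReal_re, Complex.zero_re] at h2
  have h3 := (mul_eq_zero.mp h1).resolve_left him
  rw [h3, mul_zero, zero_sub, neg_eq_zero] at h2
  refine deriv_cosProd_ne_zero hlam h2 ?_
  rw [h2, mul_zero, zero_add] at h3
  have := (mul_eq_zero.mp h3).resolve_left ha
  linarith

/-- At a zero of the combination `b + a W / Q` would equal the conjugate of `c`, so `a * Im (W / Q)`
would equal `-Im c`; but `Im (W / Q) > 0` inside the disk. -/
theorem combination_disk_ne_zero {n : ℕ} (hn : 1 ≤ n) {lam : ℝ} {c : ℂ} (hc : ‖c‖ = 1) {a b : ℝ}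
    (hac : 0 < a * c.im) {z : ℂ} (hz : ‖z‖ < 1) :
    (C c * (C (b : ℂ) * Q n lam + C (a : ℂ) * W n lam) - Q n lam).eval z ≠ 0 := by
  intro h
  have hv : ∀ k, ‖cis (beta n lam k) * z‖ < 1 := fun k => by simpa using hz
  have hne : ∀ k ∈ Finset.Icc 1 n, 1 + cis (beta n lam k) * z ≠ 0 :=
    fun k _ => one_add_ne_zero (hv k).ne
  have hQ : (Q n lam).eval z ≠ 0 := by
    rw [eval_Q]; exact Finset.prod_ne_zero_iff.mpr hne
  have hS : 0 < (∑ k ∈ Finset.Icc 1 n, cay (cis (beta n lam k) * z)).im := by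
    rw [Complex.im_sum]
    exact Finset.sum_pos (fun k _ => cay_im_pos (hv k)) ⟨1, by simp [hn]⟩
  simp only [eval_sub, eval_mul, eval_add, eval_C] at h
  rw [eval_W hne] at h
  set S := ∑ k ∈ Finset.Icc 1 n, cay (cis (beta n lam k) * z)
  have h1 : c * (b + a * S) = 1 := by
    refine mul_left_cancel₀ hQ ?_
    linear_combination h
  have h2 := congrArg Complex.im (eq_conj_of_mul_eq_one hc h1)
  rw [Complex.add_im, Complex.im_ofReal_mul, Complex.ofReal_im, Complex.conj_im, zero_add] at h2
  have h3 : a * c.im = -(a ^ 2 * S.im) := by rw [← neg_eq_iff_eq_neg.mpr h2]; ring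
  nlinarith [mul_nonneg (sq_nonneg a) hS.le]

theorem combination_degree {n : ℕ} {lam : ℝ} {c : ℂ} (hc : ‖c‖ = 1) {a b : ℝ}
    (hac : a * c.im < 0) :
    (C c * (C (b : ℂ) * Q n lam + C (a : ℂ) * W n lam) - Q n lam).degree = n := by
  refine degree_eq_of_le_of_coeff_ne_zero (natDegree_le_iff_degree_le.mp ?_) ?_
  · refine (natDegree_sub_le _ _).trans (max_le ((natDegree_C_mul_le _ _).trans
      ((natDegree_add_le _ _).trans (max_le ((natDegree_C_mul_le _ _).trans ?_)
        ((natDegree_C_mul_le _ _).trans (natDegree_W_le n lam))))) ?_) <;>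
    exact (natDegree_Q n lam).le
  · rw [coeff_sub, coeff_C_mul, coeff_add, coeff_C_mul, coeff_C_mul, coeff_W]
    intro h
    have h1 : c * (b - a * n * Complex.I) = 1 := by
      refine mul_left_cancel₀ (coeff_Q_ne_zero n lam) ?_
      linear_combination h
    have h2 := congrArg Complex.im (eq_conj_of_mul_eq_one hc h1)
    have h3 : c.im = a * n := by simpa using h2.symm
    rw [h3] at hac
    have : (0 : ℝ) ≤ n * a ^ 2 := by positivity
    nlinarith

/-! ### The combinations that belong to `DBar` -/

theorem im_one_sub_mul_div_add_pos {T U : ℂ} (hT : T.im < 0) (hU : U.im < 0) :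
    0 < ((1 - T * U) / (T + U)).im := by
  have hne : T + U ≠ 0 := fun h => by
    have := congrArg Complex.im h
    simp at this
    linarith
  rw [im_div_eq]
  refine div_pos ?_ (Complex.normSq_pos.mpr hne)
  have e : ((1 - T * U) * (starRingEnd ℂ) (T + U)).im =
      (-T.im) * (1 + U.re ^ 2 + U.im ^ 2) + (-U.im) * (1 + T.re ^ 2 + T.im ^ 2) := by
    simp [Complex.mul_im]
    ring
  rw [e]
  have := neg_pos.mpr hT
  have := neg_pos.mpr hU
  positivity

/-- Put `θ = nλ/2`. The factors that `Q₊` and `Q₋` do not share are `1 + e^{iθ} z` and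
`1 + e^{-iθ} z`. If `T` is the Cayley transform of `e^{-iθ} z` and `F₋ / Q₋ = c a (T + U)`, then the
quotient in the definition of `DBar` is `cos θ + sin θ (1 - T U) / (T + U)`, and `T` and `U`
both lie in the lower half-plane. -/
theorem combination_mem_DBar {n : ℕ} (hn : 1 ≤ n) {lam : ℝ}
    (hlam : lam ∈ Set.Ioo (0 : ℝ) (2 * Real.pi / n)) {c : ℂ} (hc : ‖c‖ = 1) {a b : ℝ}
    (hac : a * c.im < 0) :
    C c * (C (b : ℂ) * Q n lam + C (a : ℂ) * W n lam) - Q n lam ∈ DBar n lam := by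
  refine ⟨combination_degree hc hac, fun z hz => ?_⟩
  have ha : a ≠ 0 := by rintro rfl; simp at hac
  have hc0 : c ≠ 0 := norm_ne_zero_iff.mp (by rw [hc]; exact one_ne_zero)
  obtain ⟨m, hm⟩ : ∃ m, n = m + 1 := ⟨n - 1, by omega⟩
  set V : ℕ → ℂ := fun j => cis ((2 * (j : ℝ) - n) * lam / 2) * z with hV
  have hVn : ∀ j, 1 < ‖V j‖ := fun j => by simpa [hV] using hz
  have hV1 : ∀ j, 1 + V j ≠ 0 := fun j => one_add_ne_zero (hVn j).ne'
  have hplus : ∀ i : ℕ, cis (beta n lam (i + 1)) * (cis (lam / 2) * z) = V (i + 1) := by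
    intro i
    simp only [hV]
    rw [← mul_assoc, ← cis_add, beta]; push_cast; ring_nf
  have hminus : ∀ i : ℕ, cis (beta n lam (i + 1)) * (cis (-lam / 2) * z) = V i := by
    intro i
    simp only [hV]
    rw [← mul_assoc, ← cis_add, beta]; push_cast; ring_nf
  have hpne : ∀ k ∈ Finset.Icc 1 n, 1 + cis (beta n lam k) * (cis (lam / 2) * z) ≠ 0 :=
    fun k _ => one_add_ne_zero (by simpa using hz.ne')
  have hmne : ∀ k ∈ Finset.Icc 1 n, 1 + cis (beta n lam k) * (cis (-lam / 2) * z) ≠ 0 :=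
    fun k _ => one_add_ne_zero (by simpa using hz.ne')
  set M : ℂ := ∏ i ∈ Finset.range m, (1 + V (i + 1)) with hM
  set S : ℂ := ∑ i ∈ Finset.range m, cay (V (i + 1)) with hS
  have hM0 : M ≠ 0 := Finset.prod_ne_zero_iff.mpr fun i _ => hV1 _
  have hQp : (Q n lam).eval (cis (lam / 2) * z) = M * (1 + V n) := by
    rw [eval_Q, prod_Icc_one_eq_range]
    simp only [hplus]
    rw [hm, Finset.prod_range_succ]
  have hQm : (Q n lam).eval (cis (-lam / 2) * z) = M * (1 + V 0) := by
    rw [eval_Q, prod_Icc_one_eq_range]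
    simp only [hminus]
    rw [hm, Finset.prod_range_succ']
  have hWp : (W n lam).eval (cis (lam / 2) * z) = M * (1 + V n) * (S + cay (V n)) := by
    rw [eval_W hpne, hQp, sum_Icc_one_eq_range]
    simp only [hplus]
    rw [hm, Finset.sum_range_succ]
  have hWm : (W n lam).eval (cis (-lam / 2) * z) = M * (1 + V 0) * (S + cay (V 0)) := by
    rw [eval_W hmne, hQm, sum_Icc_one_eq_range]
    simp only [hminus]
    rw [hm, Finset.sum_range_succ']
  have hSim : S.im ≤ 0 := by
    rw [hS, Complex.im_sum]
    exact Finset.sum_nonpos fun i _ => (cay_im_neg (hVn _)).le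
  have hcc : c * (starRingEnd ℂ) c = 1 := by
    rw [Complex.mul_conj, Complex.normSq_eq_norm_sq, hc]; simp
  have haC : (a : ℂ) ≠ 0 := by exact_mod_cast ha
  set U : ℂ := (b - (starRingEnd ℂ) c) / a + S with hU
  have haU : a * U = b - (starRingEnd ℂ) c + a * S := by
    rw [hU, mul_add, mul_div_cancel₀ _ haC]
  have hUim : U.im < 0 := by
    have h1 : ((b - (starRingEnd ℂ) c) / a : ℂ).im = c.im / a := by
      rw [Complex.div_ofReal_im]; simp
    have h2 : c.im / a < 0 := by
      rw [show c.im / a = a * c.im / a ^ 2 by field_simp]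
      exact div_neg_of_neg_of_pos hac (by positivity)
    rw [hU, Complex.add_im, h1]
    linarith
  have hTim := cay_im_neg (hVn 0)
  set T := cay (V 0) with hT
  have hTU : T + U ≠ 0 := fun h => by
    have := congrArg Complex.im h
    rw [Complex.add_im, Complex.zero_im] at this
    linarith
  set θ : ℝ := (n : ℝ) * lam / 2 with hθ
  have hs : 0 < Real.sin θ := sin_half_pos hn hlam (by positivity) le_rfl
  have hV0 : V 0 = cis (-θ) * z := by simp only [hV, hθ]; push_cast; ring_nf
  have hVN : V n = cis θ * z := by simp only [hV, hθ]; ring_nf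
  have e1 : cis θ = Real.cos θ + Real.sin θ * Complex.I := cis_eq θ
  have e2 : cis (-θ) = Real.cos θ - Real.sin θ * Complex.I := by
    rw [cis_eq, Real.cos_neg, Real.sin_neg]; push_cast; ring
  have hT' : (1 + V 0) * T = -Complex.I * (V 0 - 1) := by
    rw [hT, cay, mul_div_cancel₀ _ (hV1 0)]
  have hTN' : (1 + V n) * cay (V n) = -Complex.I * (V n - 1) := by
    rw [cay, mul_div_cancel₀ _ (hV1 n)]
  have hFm : (minus lam (C c * (C (b : ℂ) * Q n lam + C (a : ℂ) * W n lam) - Q n lam)).eval z =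
      c * a * M * ((1 + V 0) * (T + U)) := by
    rw [eval_minus]
    simp only [eval_sub, eval_mul, eval_add, eval_C, hQm, hWm]
    linear_combination (-c * M * (1 + V 0)) * haU + M * (1 + V 0) * hcc
  have hFp : (plus lam (C c * (C (b : ℂ) * Q n lam + C (a : ℂ) * W n lam) - Q n lam)).eval z =
      c * a * M * ((1 + V n) * (cay (V n) + U)) := by
    rw [eval_plus]
    simp only [eval_sub, eval_mul, eval_add, eval_C, hQp, hWp]
    linear_combination (-c * M * (1 + V n)) * haU + M * (1 + V n) * hcc
  have hmain : cis (-θ) * ((1 + V n) * (cay (V n) + U)) =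
      (Real.cos θ + Real.sin θ * ((1 - T * U) / (T + U))) * ((1 + V 0) * (T + U)) := by
    have h1 : (Real.cos θ + Real.sin θ * ((1 - T * U) / (T + U))) * ((1 + V 0) * (T + U)) =
        (1 + V 0) * (Real.cos θ * (T + U) + Real.sin θ * (1 - T * U)) := by
      field_simp
    rw [h1, mul_add (1 + V n), hTN']
    have h2 : (1 + V 0) * (Real.cos θ * (T + U) + Real.sin θ * (1 - T * U)) =
        (Real.cos θ - Real.sin θ * U) * ((1 + V 0) * T) +
          (1 + V 0) * (Real.cos θ * U + Real.sin θ) := by ring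
    rw [h2, hT', hV0, hVN, e1, e2]
    linear_combination (-Real.sin θ * (1 + z * (Real.cos θ - Real.sin θ * Complex.I)) : ℂ) *
      Complex.I_sq
  have hden : (1 + V 0) * (T + U) ≠ 0 := mul_ne_zero (hV1 0) hTU
  rw [hFm, hFp, mul_div_mul_left _ _ (mul_ne_zero (mul_ne_zero hc0 haC) hM0), ← mul_div_assoc,
    hmain, mul_div_cancel_right₀ _ hden, Complex.add_im, Complex.ofReal_im, zero_add,
    Complex.im_ofReal_mul]
  exact mul_pos hs (im_one_sub_mul_div_add_pos hTim hUim)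

/-! ### The characterization -/

theorem mem_DBar_diff_TBar_of_combination {n : ℕ} (hn : 1 ≤ n) {lam : ℝ}
    (hlam : lam ∈ Set.Ioo (0 : ℝ) (2 * Real.pi / n)) {c : ℂ} (hc : ‖c‖ = 1) {a b : ℝ}
    (hac : a * c.im < 0) :
    C c * (C (b : ℂ) * Q n lam + C (a : ℂ) * W n lam) - Q n lam ∈ DBar n lam \ TBar n lam := by
  refine ⟨combination_mem_DBar hn hlam hc hac, fun hT => ?_⟩
  have hdeg := combination_degree (n := n) (lam := lam) (b := b) hc hac
  obtain ⟨z, hz⟩ := IsAlgClosed.exists_root _ (by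
    rw [hdeg]; exact_mod_cast (Nat.pos_of_ne_zero (by omega : n ≠ 0)).ne')
  have hz1 : ‖z‖ = 1 := by simpa using hT.1.2 z hz
  exact combination_circle_ne_zero hlam (right_ne_zero_of_mul hac.ne) (left_ne_zero_of_mul hac.ne)
    hz1 hz

theorem exists_combination_of_mem_DBar_diff_TBar {n : ℕ} (hn : 1 ≤ n) {lam : ℝ}
    (hlam : lam ∈ Set.Ioo (0 : ℝ) (2 * Real.pi / n)) {P : ℂ[X]}
    (hP : P ∈ piClass n (Metric.sphere 0 1)) (hF : P - Q n lam ∈ DBar n lam \ TBar n lam) :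
    ∃ (c : ℂ) (a b : ℝ), ‖c‖ = 1 ∧ a * c.im < 0 ∧
      P = C c * (C (b : ℂ) * Q n lam + C (a : ℂ) * W n lam) := by
  obtain ⟨hD, hT⟩ := hF
  obtain ⟨c, r, hc, hr⟩ := exists_trig_eq_mul_real hP
  by_cases him : c.im = 0
  · refine absurd (DBar.mem_TBar_of_real hn hlam hD (c := 1)
      (r := fun t => c.re * r t - cosProd n lam t) norm_one fun t => ?_) hT
    have hcr : c = (c.re : ℂ) := Complex.ext rfl (by simpa using him)
    rw [trig_sub, hr, trig_Q]
    nth_rewrite 1 [hcr]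
    push_cast; ring
  · obtain ⟨a, b, hab⟩ := DBar.exists_eq_combination hn hlam
      (natDegree_eq_of_degree_eq_some hP.1).le hc him hr hD
    refine ⟨c, a, b, hc, ?_, hab⟩
    rw [hab] at hD hT
    refine lt_of_le_of_ne (DBar.mul_im_nonpos hn hlam hD) (mul_ne_zero ?_ him)
    rintro rfl
    have hK : C c * (C (b : ℂ) * Q n lam + C ((0 : ℝ) : ℂ) * W n lam) - Q n lam =
        C (c * b - 1) * Q n lam := by
      rw [Complex.ofReal_zero, C_0, C_sub, C_mul, C_1]; ring
    rw [hK] at hD hT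
    have hK0 : (‖c * b - 1‖ : ℂ) ≠ 0 := by
      intro h
      have h' : c * b - 1 = 0 := by simpa using h
      have := hD.1
      simp [h'] at this
    refine hT (DBar.mem_TBar_of_real hn hlam hD (c := (c * b - 1) / ‖c * b - 1‖)
      (r := fun t => ‖c * b - 1‖ * cosProd n lam t) ?_ fun t => ?_)
    · rw [norm_div, Complex.norm_real, norm_norm, div_self (by exact_mod_cast hK0)]
    · rw [trig_C_mul, trig_Q]
      push_cast
      field_simp

theorem im_ne_zero_iff_of_norm_eq_one {c : ℂ} (hc : ‖c‖ = 1) : c.im ≠ 0 ↔ c ≠ 1 ∧ c ≠ -1 := by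
  constructor
  · intro h
    constructor <;> rintro rfl <;> simp at h
  · rintro ⟨h1, h2⟩ h
    have hcr : c = (c.re : ℂ) := Complex.ext rfl (by simpa using h)
    rw [hcr, Complex.norm_real, Real.norm_eq_abs] at hc
    rcases eq_or_eq_neg_of_abs_eq hc with h' | h'
    · exact h1 (by rw [hcr, h']; simp)
    · exact h2 (by rw [hcr, h']; simp)

end CirclePoly

end

theorem mainTheorem8 (n : ℕ) (hn : 1 ≤ n) (lam : ℝ)
    (hlam : lam ∈ Set.Ioo (0 : ℝ) (2 * Real.pi / n))
    (P : Polynomial ℂ) (hP : P ∈ CirclePoly.piClass n (Metric.sphere (0 : ℂ) 1)) :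
    (P - CirclePoly.Q n lam ∈ CirclePoly.piClass n (Metric.closedBall (0 : ℂ) 1) →
      (P - CirclePoly.Q n lam ∈ CirclePoly.DBar n lam \ CirclePoly.TBar n lam ↔
        ∃ (c : ℂ) (a b : ℝ), ‖c‖ = 1 ∧ c ≠ 1 ∧ c ≠ -1 ∧ a ≠ 0 ∧
          CirclePoly.HasForm n lam P c a b)) ∧
    (P - CirclePoly.Q n lam ∈ CirclePoly.DBar n lam \ CirclePoly.TBar n lam ↔
      ∃ (c : ℂ) (a b : ℝ), ‖c‖ = 1 ∧ c ≠ 1 ∧ c ≠ -1 ∧ a * c.im < 0 ∧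
        CirclePoly.HasForm n lam P c a b) := by
  have main : P - CirclePoly.Q n lam ∈ CirclePoly.DBar n lam \ CirclePoly.TBar n lam ↔
      ∃ (c : ℂ) (a b : ℝ), ‖c‖ = 1 ∧ c ≠ 1 ∧ c ≠ -1 ∧ a * c.im < 0 ∧
        CirclePoly.HasForm n lam P c a b := by
    constructor
    · intro hF
      obtain ⟨c, a, b, hc, hac, h⟩ :=
        CirclePoly.exists_combination_of_mem_DBar_diff_TBar hn hlam hP hF
      obtain ⟨h1, h2⟩ :=
        (CirclePoly.im_ne_zero_iff_of_norm_eq_one hc).mp (right_ne_zero_of_mul hac.ne)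
      refine ⟨c, a, b - a * CirclePoly.cotSum n lam, hc, h1, h2, hac, ?_⟩
      rw [CirclePoly.hasForm_iff hlam, sub_add_cancel]
      exact h
    · rintro ⟨c, a, b, hc, -, -, hac, h⟩
      rw [(CirclePoly.hasForm_iff hlam P c a b).mp h]
      exact CirclePoly.mem_DBar_diff_TBar_of_combination hn hlam hc hac
  refine ⟨fun hF => ⟨fun h => ?_, ?_⟩, main⟩
  · obtain ⟨c, a, b, hc, h1, h2, hac, h⟩ := main.mp h
    exact ⟨c, a, b, hc, h1, h2, left_ne_zero_of_mul hac.ne, h⟩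
  · rintro ⟨c, a, b, hc, h1, h2, ha, h⟩
    refine main.mpr ⟨c, a, b, hc, h1, h2, ?_, h⟩
    have him := (CirclePoly.im_ne_zero_iff_of_norm_eq_one hc).mpr ⟨h1, h2⟩
    by_contra! hge
    have hpos : 0 < a * c.im := lt_of_le_of_ne hge (mul_ne_zero ha him).symm
    obtain ⟨z, hz⟩ := IsAlgClosed.exists_root _ (by
      rw [hF.1]; exact_mod_cast (Nat.pos_of_ne_zero (by omega : n ≠ 0)).ne')
    have hz1 : ‖z‖ ≤ 1 := by simpa using hF.2 z hz
    rw [(CirclePoly.hasForm_iff hlam P c a b).mp h] at hz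
    rcases hz1.eq_or_lt with hz1 | hz1
    · exact CirclePoly.combination_circle_ne_zero hlam him ha hz1 hz
    · exact CirclePoly.combination_disk_ne_zero hn hc hpos hz1 hz
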